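/- Let $D$ be a probability distribution of test examples $(X,Y)$ and $M$ a probability distribution of pre-training seeds $S$. For each seed $s$ let $f_s$ be the resulting model, and let $\ell(x,y,f_s)\in\mathbb R$ be a per-example loss, measurable in $(x,y,s)$. Put $L(s)=\mathbb E_{D}[\ell(X,Y,f_s)]$ and $\theta=\mathbb E_{S\sim M}[L(S)]$. Let $(X_1,Y_1),(X_2,Y_2),\dots$ be i.i.d. with law $D$, and $S_1,S_2,\dots$ i.i.d. with law $M$, the two sequences being independent. Given numbers $n_x$ of examples and $n_s$ of seeds, let $$\widehat\theta=\frac1{n_s}\sum_{j=1}^{n_s}\frac1{n_x}\sum_{i=1}^{n_x}\ell(X_i,Y_i,f_{S_j}).$$ Draw $(X_1^*,Y_1^*),\dots,(X_{n_x}^*,Y_{n_x}^*)$ uniformly with replacement from $(X_1,Y_1),\dots,(X_{n_x},Y_{n_x})$ and, independently, $S_1^*,\dots,S_{n_s}^*$ uniformly with replacement from $S_1,\dots,S_{n_s}$, the choice of indices being independent of the data, and let $$\widehat\theta^*=\frac1{n_s}\sum_{j=1}^{n_s}\frac1{n_x}\sum_{i=1}^{n_x}\ell(X_i^*,Y_i^*,f_{S_j^*}).$$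 Assume that $\mathbb E[\ell^2(X,Y,f_S)]<\infty$ for $((X,Y),S)\sim D\times M$, that $\mathbb E[\ell^2(X,Y,f_s)]<\infty$ for each $s$, and that $\mathbb E[\ell^2(X,Y,f_S)\mid X=x,Y=y]<\infty$ for almost every $(x,y)$. Assume also that the functions $s\mapsto L(s)$ and $(x,y)\mapsto\mathbb E_{S\sim M}[\ell(x,y,f_S)]$ are not both almost surely constant (with respect to $M$ and $D$, respectively). Let $n=n_x+n_s\to\infty$ with $n_s=p_sn$ up to rounding error, i.e. $|n_s-p_sn|<1$, for a fixed $0<p_s<1$. Then there exists $0<\sigma^2<\infty$ such that $\sqrt n(\widehat\theta-\theta)$ converges in distribution to $\mathcal N(0,\sigma^2)$. Furthermore, almost surely, the conditional law of $\sqrt n(\widehat\theta^*-\widehat\theta)$ given all the data $((X_i,Y_i))_{i\ge1}$, $(S_j)_{j\ge1}$ converges weakly to the same $\mathcal N(0,\sigma^2)$, and so does, almost surely, its conditional law given the examples $((X_i,Y_i))_{i\ge1}$ alone. -/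

import Mathlib

open MeasureTheory ProbabilityTheory Filter Topology
open scoped NNReal ENNReal

namespace MultiBootstrap

noncomputable section

/-- The expected performance `L(s) = E_D[ℓ(X, Y, f_s)]` of the model with seed `s`. -/
def performance {𝒳 𝒴 𝒮 ℱ : Type*} [MeasurableSpace 𝒳] [MeasurableSpace 𝒴]
    (ℓ : 𝒳 → 𝒴 → ℱ → ℝ) (f : 𝒮 → ℱ) (D : Measure (𝒳 × 𝒴)) (s : 𝒮) : ℝ :=
  ∫ z, ℓ z.1 z.2 (f s) ∂D

/-- The expected loss over seeds on a fixed example, `E_M[ℓ(x, y, f_S)]`. -/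
def exampleMean {𝒳 𝒴 𝒮 ℱ : Type*} [MeasurableSpace 𝒮]
    (ℓ : 𝒳 → 𝒴 → ℱ → ℝ) (f : 𝒮 → ℱ) (M : Measure 𝒮) (z : 𝒳 × 𝒴) : ℝ :=
  ∫ s, ℓ z.1 z.2 (f s) ∂M

/-- The target `θ = E_{S ∼ M}[L(S)]`. -/
def theta {𝒳 𝒴 𝒮 ℱ : Type*} [MeasurableSpace 𝒳] [MeasurableSpace 𝒴] [MeasurableSpace 𝒮]
    (ℓ : 𝒳 → 𝒴 → ℱ → ℝ) (f : 𝒮 → ℱ) (D : Measure (𝒳 × 𝒴)) (M : Measure 𝒮) : ℝ :=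
  ∫ s, performance ℓ f D s ∂M

/-- The average loss of the model `g` on the examples `z 0, …, z (m - 1)`. -/
def empPerformance {𝒳 𝒴 ℱ : Type*} {m : ℕ}
    (ℓ : 𝒳 → 𝒴 → ℱ → ℝ) (z : Fin m → 𝒳 × 𝒴) (g : ℱ) : ℝ :=
  (1 / (m : ℝ)) * ∑ i, ℓ (z i).1 (z i).2 g

/-- The two-way average of the loss over the examples `z` and the seeds `s`. -/
def empTheta {𝒳 𝒴 𝒮 ℱ : Type*} {m k : ℕ}
    (ℓ : 𝒳 → 𝒴 → ℱ → ℝ) (f : 𝒮 → ℱ) (z : Fin m → 𝒳 × 𝒴) (s : Fin k → 𝒮) : ℝ :=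
  (1 / (k : ℝ)) * ∑ j, empPerformance ℓ z (f (s j))

/-- The examples `Z 0, Z 1, …` are i.i.d. with law `D`, the seeds `S 0, S 1, …` are i.i.d. with
law `M`, and the two sequences are independent of each other. -/
structure IsTwoWaySample {Ω 𝒵 𝒮 : Type*} [MeasurableSpace Ω] [MeasurableSpace 𝒵]
    [MeasurableSpace 𝒮] (P : Measure Ω) (D : Measure 𝒵) (M : Measure 𝒮)
    (Z : ℕ → Ω → 𝒵) (S : ℕ → Ω → 𝒮) : Prop where
  measurable_example : ∀ i, Measurable (Z i)
  measurable_seed : ∀ j, Measurable (S j)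
  law_example : ∀ i, P.map (Z i) = D
  law_seed : ∀ j, P.map (S j) = M
  indep_example : iIndepFun Z P
  indep_seed : iIndepFun S P
  indep : IndepFun (fun ω i ↦ Z i ω) (fun ω j ↦ S j ω) P

/-- `I` lists `m` indices drawn uniformly with replacement from `m` items, `J` lists `k` indices
drawn uniformly with replacement from `k` items, all the draws are independent of one another,
and they are jointly independent of the data `V`. -/
structure IsTwoWayResample {Ω 𝒱 : Type*} [MeasurableSpace Ω] [MeasurableSpace 𝒱]
    (P : Measure Ω) (V : Ω → 𝒱) {m k : ℕ} (I : Ω → Fin m → Fin m) (J : Ω → Fin k → Fin k) :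
    Prop where
  measurable_left : Measurable I
  measurable_right : Measurable J
  uniform_left : ∀ i a, P {ω | I ω i = a} = (m : ℝ≥0∞)⁻¹
  uniform_right : ∀ j b, P {ω | J ω j = b} = (k : ℝ≥0∞)⁻¹
  iIndep_left : iIndepFun (fun i ω ↦ I ω i) P
  iIndep_right : iIndepFun (fun j ω ↦ J ω j) P
  indep : IndepFun I J P
  indep_data : IndepFun V (fun ω ↦ (I ω, J ω)) P

/-- Conditionally on `V`, the real random variables `T n` converge in distribution to the
probability measure `ν`: almost surely, the (regular) conditional laws of `T n` given `V`
converge weakly to `ν`. -/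
def CondTendstoInDistribution {Ω 𝒱 : Type*} [MeasurableSpace Ω] [MeasurableSpace 𝒱]
    (T : ℕ → Ω → ℝ) (V : Ω → 𝒱) (P : Measure Ω) [IsFiniteMeasure P]
    (ν : Measure ℝ) [IsProbabilityMeasure ν] : Prop :=
  ∀ᵐ ω ∂P, Tendsto (β := ProbabilityMeasure ℝ)
    (fun n ↦ ⟨condDistrib (T n) V P (V ω), inferInstance⟩) atTop (𝓝 ⟨ν, inferInstance⟩)

end

end MultiBootstrap

/-!
Write the loss as a kernel `g (z, s)` of an example `z` and a seed `s`, square integrable for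
`D × M`, and split it as `g (z, s) = θ + a z + b s + r (z, s)` into its mean, the two main effects
and an interaction whose integral over either variable vanishes. The two-way average of `g` is then
`θ` plus the average of `a` over the examples, plus the average of `b` over the seeds, plus the
average of `r`. The first two averages are independent and obey the central limit theorem at scale
`√n`, with limiting variances `Var a / (1 - p)` and `Var b / p`; the average of `r` has variance of
order `1 / n²` and disappears. The limiting variance is positive because `a` and `b` are not both
almost surely zero.

The bootstrap repeats this with `D` and `M` replaced by the uniform laws on the observed examples
and seeds. Both cases are instances of `tendsto_charFun_of_twoWayIID`, a limit theorem for
characteristic functions in which the two laws and the kernel change with `n`. It asks for a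
Lindeberg condition on the main effects and for a remainder `r` for which three quantities are
small: its second moment divided by the number of rows, and the second moments of its two
conditional means.
For fixed data these are properties of the data, collected in `IsTypicalArray`, and what remains is
that almost every data set is typical (`TwoWayIID.ae_isTypicalArray`). The statements on the main
effects are the strong law of large numbers. The statements on the interaction follow from
second moments, which are summable along the squares `n = l²`, together with a Cauchy-Schwarz
bound for the sample sizes between two consecutive squares
(`TwoWayIID.ae_tendsto_mean_sq_mean`).

Since the resampled indices are independent of the data, the conditional law given all the data is
obtained by freezing the data. Conditionally on the examples alone, that law is averaged over the
seeds, and dominated convergence for characteristic functions, with Lévy's theorem, gives the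
same limit.
-/

namespace MultiBootstrap

/-! ### Independent two-way samples and second moments of two-way sums -/

/-- The families `Z` and `S` are i.i.d. with laws `D` and `M`, and independent of each other. The
index types are arbitrary, so that the notion covers the infinite data sequences, their finite
initial segments, and the resampled indices. -/
structure TwoWayIID {Ω 𝒵 𝒮 ι κ : Type*} [MeasurableSpace Ω] [MeasurableSpace 𝒵]
    [MeasurableSpace 𝒮] (P : Measure Ω) (D : Measure 𝒵) (M : Measure 𝒮)
    (Z : ι → Ω → 𝒵) (S : κ → Ω → 𝒮) : Prop where
  measurable_left : ∀ i, Measurable (Z i)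
  measurable_right : ∀ j, Measurable (S j)
  law_left : ∀ i, P.map (Z i) = D
  law_right : ∀ j, P.map (S j) = M
  indep_left : iIndepFun Z P
  indep_right : iIndepFun S P
  indep : IndepFun (fun ω i ↦ Z i ω) (fun ω j ↦ S j ω) P

theorem IsTwoWaySample.twoWayIID {Ω 𝒵 𝒮 : Type*} [MeasurableSpace Ω] [MeasurableSpace 𝒵]
    [MeasurableSpace 𝒮] {P : Measure Ω} {D : Measure 𝒵} {M : Measure 𝒮}
    {Z : ℕ → Ω → 𝒵} {S : ℕ → Ω → 𝒮} (h : IsTwoWaySample P D M Z S) : TwoWayIID P D M Z S :=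
  ⟨h.measurable_example, h.measurable_seed, h.law_example, h.law_seed, h.indep_example,
    h.indep_seed, h.indep⟩

namespace TwoWayIID

variable {Ω 𝒵 𝒮 ι κ : Type*} [MeasurableSpace Ω] [MeasurableSpace 𝒵] [MeasurableSpace 𝒮]
  {P : Measure Ω} {D : Measure 𝒵} {M : Measure 𝒮} {Z : ι → Ω → 𝒵} {S : κ → Ω → 𝒮}

theorem swap (h : TwoWayIID P D M Z S) : TwoWayIID P M D S Z :=
  ⟨h.measurable_right, h.measurable_left, h.law_right, h.law_left, h.indep_right, h.indep_left,
    h.indep.symm⟩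

theorem reindex (h : TwoWayIID P D M Z S) {ι' κ' : Type*} {e : ι' → ι} {e' : κ' → κ}
    (he : e.Injective) (he' : e'.Injective) :
    TwoWayIID P D M (fun i ↦ Z (e i)) (fun j ↦ S (e' j)) where
  measurable_left _ := h.measurable_left _
  measurable_right _ := h.measurable_right _
  law_left _ := h.law_left _
  law_right _ := h.law_right _
  indep_left := h.indep_left.precomp he
  indep_right := h.indep_right.precomp he'
  indep := h.indep.comp (φ := fun z i ↦ z (e i)) (ψ := fun s j ↦ s (e' j))
    (measurable_pi_lambda _ fun _ ↦ measurable_pi_apply _)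
    (measurable_pi_lambda _ fun _ ↦ measurable_pi_apply _)

theorem map_pair [IsProbabilityMeasure P] (h : TwoWayIID P D M Z S) (i : ι) (j : κ) :
    P.map (fun ω ↦ (Z i ω, S j ω)) = D.prod M := by
  have hi : IndepFun (Z i) (S j) P :=
    h.indep.comp (φ := fun z : ι → 𝒵 ↦ z i) (ψ := fun s : κ → 𝒮 ↦ s j) (measurable_pi_apply i)
      (measurable_pi_apply j)
  rw [(indepFun_iff_map_prod_eq_prod_map_map (h.measurable_left i).aemeasurable
    (h.measurable_right j).aemeasurable).1 hi, h.law_left, h.law_right]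

theorem measurable_pair (h : TwoWayIID P D M Z S) (i : ι) (j : κ) :
    Measurable (fun ω ↦ (Z i ω, S j ω)) :=
  (h.measurable_left i).prodMk (h.measurable_right j)

theorem memLp_kernel [IsProbabilityMeasure P] (h : TwoWayIID P D M Z S) {g : 𝒵 × 𝒮 → ℝ}
    {q : ℝ≥0∞} (hg : MemLp g q (D.prod M)) (i : ι) (j : κ) :
    MemLp (fun ω ↦ g (Z i ω, S j ω)) q P := by
  rw [← h.map_pair i j] at hg
  exact hg.comp_of_map (h.measurable_pair i j).aemeasurable

theorem integral_kernel [IsProbabilityMeasure P] (h : TwoWayIID P D M Z S) {g : 𝒵 × 𝒮 → ℝ}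
    (hg : Measurable g) (i : ι) (j : κ) :
    ∫ ω, g (Z i ω, S j ω) ∂P = ∫ q, g q ∂(D.prod M) := by
  rw [← h.map_pair i j, integral_map (h.measurable_pair i j).aemeasurable
    hg.aestronglyMeasurable]

/-- Two kernel values in different columns are conditionally independent given the rows, so each may
be replaced by its conditional mean. The rows `i` and `i'` may coincide. -/
theorem integral_kernel_mul_kernel [IsProbabilityMeasure P] [IsProbabilityMeasure M]
    (h : TwoWayIID P D M Z S) {g : 𝒵 × 𝒮 → ℝ} (hg : Measurable g) (hg2 : MemLp g 2 (D.prod M))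
    (i i' : ι) {j j' : κ} (hj : j ≠ j') :
    ∫ ω, g (Z i ω, S j ω) * g (Z i' ω, S j' ω) ∂P =
      ∫ ω, (∫ s, g (Z i ω, s) ∂M) * (∫ s, g (Z i' ω, s) ∂M) ∂P := by
  have hZ := h.measurable_left
  have hS := h.measurable_right
  have hW : Measurable (fun ω ↦ (Z i ω, Z i' ω)) := (hZ i).prodMk (hZ i')
  have hV : Measurable (fun ω ↦ (S j ω, S j' ω)) := (hS j).prodMk (hS j')
  have hmap : P.map (fun ω ↦ ((Z i ω, Z i' ω), (S j ω, S j' ω))) =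
      (P.map (fun ω ↦ (Z i ω, Z i' ω))).prod (M.prod M) := by
    have hi : IndepFun (fun ω ↦ (Z i ω, Z i' ω)) (fun ω ↦ (S j ω, S j' ω)) P :=
      h.indep.comp (φ := fun z ↦ (z i, z i')) (ψ := fun s ↦ (s j, s j'))
        ((measurable_pi_apply i).prodMk (measurable_pi_apply i'))
        ((measurable_pi_apply j).prodMk (measurable_pi_apply j'))
    rw [(indepFun_iff_map_prod_eq_prod_map_map hW.aemeasurable hV.aemeasurable).1 hi,
      (indepFun_iff_map_prod_eq_prod_map_map (hS j).aemeasurable (hS j').aemeasurable).1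
        (h.indep_right.indepFun hj), h.law_right, h.law_right]
  have hG : Measurable (fun q : (𝒵 × 𝒵) × (𝒮 × 𝒮) ↦ g (q.1.1, q.2.1) * g (q.1.2, q.2.2)) :=
    (hg.comp (by fun_prop)).mul (hg.comp (by fun_prop))
  have hint : Integrable (fun q : (𝒵 × 𝒵) × (𝒮 × 𝒮) ↦ g (q.1.1, q.2.1) * g (q.1.2, q.2.2))
      ((P.map (fun ω ↦ (Z i ω, Z i' ω))).prod (M.prod M)) := by
    rw [← hmap, integrable_map_measure hG.aestronglyMeasurable (hW.prodMk hV).aemeasurable]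
    exact (h.memLp_kernel hg2 i j).integrable_mul (h.memLp_kernel hg2 i' j')
  have hprob : IsProbabilityMeasure (P.map (fun ω ↦ (Z i ω, Z i' ω))) :=
    Measure.isProbabilityMeasure_map hW.aemeasurable
  have h1 : ∫ ω, g (Z i ω, S j ω) * g (Z i' ω, S j' ω) ∂P =
      ∫ q, g (q.1.1, q.2.1) * g (q.1.2, q.2.2)
        ∂((P.map (fun ω ↦ (Z i ω, Z i' ω))).prod (M.prod M)) := by
    rw [← hmap, integral_map (hW.prodMk hV).aemeasurable hG.aestronglyMeasurable]
  have hm : StronglyMeasurable fun z ↦ ∫ s, g (z, s) ∂M :=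
    hg.stronglyMeasurable.integral_prod_right'
  rw [h1, integral_prod _ hint]
  have h2 : ∀ w : 𝒵 × 𝒵, ∫ v : 𝒮 × 𝒮, g (w.1, v.1) * g (w.2, v.2) ∂(M.prod M) =
      (∫ s, g (w.1, s) ∂M) * (∫ s, g (w.2, s) ∂M) := fun w ↦
    integral_prod_mul (fun s ↦ g (w.1, s)) (fun s ↦ g (w.2, s))
  simp_rw [h2]
  rw [integral_map hW.aemeasurable]
  exact ((hm.comp_measurable measurable_fst).mul
    (hm.comp_measurable measurable_snd)).aestronglyMeasurable

/-- The correlation of two kernel values vanishes when they share neither row nor column. -/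
theorem integral_kernel_mul_kernel_le [IsProbabilityMeasure P] [IsProbabilityMeasure D]
    [IsProbabilityMeasure M]
    (h : TwoWayIID P D M Z S) {g : 𝒵 × 𝒮 → ℝ} (hg : Measurable g) (hg2 : MemLp g 2 (D.prod M))
    (h0 : ∫ q, g q ∂(D.prod M) = 0) [DecidableEq ι] [DecidableEq κ] (x y : ι × κ) :
    ∫ ω, g (Z x.1 ω, S x.2 ω) * g (Z y.1 ω, S y.2 ω) ∂P ≤
      (if x = y then ∫ q, g q ^ 2 ∂(D.prod M) else 0) +
      (if x.1 = y.1 then ∫ z, (∫ s, g (z, s) ∂M) ^ 2 ∂D else 0) +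
      (if x.2 = y.2 then ∫ s, (∫ z, g (z, s) ∂D) ^ 2 ∂M else 0) := by
  have hB : 0 ≤ ∫ z, (∫ s, g (z, s) ∂M) ^ 2 ∂D := integral_nonneg fun _ ↦ sq_nonneg _
  have hC : 0 ≤ ∫ s, (∫ z, g (z, s) ∂D) ^ 2 ∂M := integral_nonneg fun _ ↦ sq_nonneg _
  have hm : StronglyMeasurable fun z ↦ ∫ s, g (z, s) ∂M :=
    hg.stronglyMeasurable.integral_prod_right'
  have hm' : StronglyMeasurable fun s ↦ ∫ z, g (z, s) ∂D :=
    hg.stronglyMeasurable.integral_prod_left'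
  obtain ⟨i, j⟩ := x
  obtain ⟨i', j'⟩ := y
  by_cases hj : j = j'
  · subst hj
    by_cases hi : i = i'
    · subst hi
      have := h.integral_kernel (g := fun q ↦ g q ^ 2) (hg.pow_const 2) i j
      simp only [if_true, ← sq]
      rw [this]
      linarith
    · have key := h.swap.integral_kernel_mul_kernel (g := fun q ↦ g q.swap)
        (hg.comp measurable_swap) (hg2.comp_measurePreserving Measure.measurePreserving_swap)
        j j hi
      simp only [Prod.swap_prod_mk, ← sq] at key
      have h3 : ∫ ω, (∫ z, g (z, S j ω) ∂D) ^ 2 ∂P = ∫ s, (∫ z, g (z, s) ∂D) ^ 2 ∂M := by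
        rw [← h.law_right j, integral_map (h.measurable_right j).aemeasurable
          (by rw [h.law_right]; exact (hm'.pow 2).aestronglyMeasurable)]
      simp [hi, key, h3]
  · have key := h.integral_kernel_mul_kernel hg hg2 i i' hj
    by_cases hi : i = i'
    · subst hi
      have h3 : ∫ ω, (∫ s, g (Z i ω, s) ∂M) ^ 2 ∂P = ∫ z, (∫ s, g (z, s) ∂M) ^ 2 ∂D := by
        rw [← h.law_left i, integral_map (h.measurable_left i).aemeasurable
          (by rw [h.law_left]; exact (hm.pow 2).aestronglyMeasurable)]
      simp only [← sq] at key
      simp [hj, key, h3]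
    -- distinct rows and columns: the two conditional means are independent and centred
    · have h4 : ∫ ω, (∫ s, g (Z i ω, s) ∂M) * (∫ s, g (Z i' ω, s) ∂M) ∂P = 0 := by
        have hind : IndepFun (fun ω ↦ ∫ s, g (Z i ω, s) ∂M) (fun ω ↦ ∫ s, g (Z i' ω, s) ∂M) P :=
          (h.indep_left.indepFun hi).comp hm.measurable hm.measurable
        rw [hind.integral_fun_mul_eq_mul_integral
          (hm.comp_measurable (h.measurable_left i)).aestronglyMeasurable
          (hm.comp_measurable (h.measurable_left i')).aestronglyMeasurable]
        have : ∫ ω, (∫ s, g (Z i ω, s) ∂M) ∂P = 0 := by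
          rw [← h0, integral_prod _ (hg2.integrable (by norm_num)), ← h.law_left i,
            integral_map (h.measurable_left i).aemeasurable
              (by rw [h.law_left]; exact hm.aestronglyMeasurable)]
        rw [this, zero_mul]
      simp [hi, hj, key, h4]

/-- The second moment of a centred two-way sum. The last two terms are the contributions of pairs in
a common row or a common column; they vanish for a kernel that is degenerate in both variables. -/
theorem integral_sq_sum_sum_le [IsProbabilityMeasure P] [IsProbabilityMeasure D]
    [IsProbabilityMeasure M]
    (h : TwoWayIID P D M Z S) {g : 𝒵 × 𝒮 → ℝ} (hg : Measurable g) (hg2 : MemLp g 2 (D.prod M))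
    (h0 : ∫ q, g q ∂(D.prod M) = 0) (A : Finset ι) (B : Finset κ) :
    ∫ ω, (∑ i ∈ A, ∑ j ∈ B, g (Z i ω, S j ω)) ^ 2 ∂P ≤
      A.card * B.card * ∫ q, g q ^ 2 ∂(D.prod M) +
      A.card * (B.card : ℝ) ^ 2 * ∫ z, (∫ s, g (z, s) ∂M) ^ 2 ∂D +
      (A.card : ℝ) ^ 2 * B.card * ∫ s, (∫ z, g (z, s) ∂D) ^ 2 ∂M := by
  classical
  have hexp : ∀ ω, (∑ i ∈ A, ∑ j ∈ B, g (Z i ω, S j ω)) ^ 2 =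
      ∑ x ∈ A ×ˢ B, ∑ y ∈ A ×ˢ B, g (Z x.1 ω, S x.2 ω) * g (Z y.1 ω, S y.2 ω) := by
    intro ω
    rw [sq, ← Finset.sum_product', Finset.sum_mul_sum]
  simp_rw [hexp]
  rw [integral_finsetSum _ fun x _ ↦ integrable_finsetSum _ fun y _ ↦
    (h.memLp_kernel hg2 x.1 x.2).integrable_mul (h.memLp_kernel hg2 y.1 y.2)]
  rw [Finset.sum_congr rfl fun x _ ↦ integral_finsetSum _ fun y _ ↦
    (h.memLp_kernel hg2 x.1 x.2).integrable_mul (h.memLp_kernel hg2 y.1 y.2)]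
  refine (Finset.sum_le_sum fun x _ ↦ Finset.sum_le_sum fun y _ ↦
    h.integral_kernel_mul_kernel_le hg hg2 h0 x y).trans (le_of_eq ?_)
  simp only [Finset.sum_add_distrib]
  congr 1
  · congr 1
    · rw [Finset.sum_congr rfl fun x hx ↦ (Finset.sum_ite_eq (A ×ˢ B) x _).trans (if_pos hx)]
      simp [Finset.card_product]
    · rw [Finset.sum_congr rfl (g := fun _ ↦ (B.card : ℝ) * ∫ z, (∫ s, g (z, s) ∂M) ^ 2 ∂D)]
      · simp [Finset.card_product]
        ring
      · intro x hx
        rw [Finset.sum_product_right, Finset.sum_congr rfl fun y _ ↦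
          (Finset.sum_ite_eq A x.1 _).trans (if_pos (Finset.mem_product.1 hx).1)]
        simp
  · rw [Finset.sum_congr rfl (g := fun _ ↦ (A.card : ℝ) * ∫ s, (∫ z, g (z, s) ∂D) ^ 2 ∂M)]
    · simp [Finset.card_product]
      ring
    · intro x hx
      rw [Finset.sum_product, Finset.sum_congr rfl fun y _ ↦
        (Finset.sum_ite_eq B x.2 _).trans (if_pos (Finset.mem_product.1 hx).2)]
      simp

end TwoWayIID

/-! ### A central limit theorem for characteristic functions under a Lindeberg condition -/

theorem sq_integral_le {Ω : Type*} [MeasurableSpace Ω] {μ : Measure Ω} [IsProbabilityMeasure μ]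
    {X : Ω → ℝ} (hX : MemLp X 2 μ) : (∫ ω, X ω ∂μ) ^ 2 ≤ ∫ ω, X ω ^ 2 ∂μ := by
  have h1 := variance_eq_sub hX
  have h2 := variance_nonneg X μ
  simp only [Pi.pow_apply] at h1
  linarith

theorem integral_sub_integral_sq {Ω : Type*} [MeasurableSpace Ω] {μ : Measure Ω}
    [IsProbabilityMeasure μ] {X : Ω → ℝ} (hX : MemLp X 2 μ) :
    ∫ ω, (X ω - ∫ ω', X ω' ∂μ) ^ 2 ∂μ = (∫ ω, X ω ^ 2 ∂μ) - (∫ ω, X ω ∂μ) ^ 2 := by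
  have h1 := variance_eq_sub hX
  rw [variance_eq_integral hX.1.aemeasurable] at h1
  simpa using h1

theorem norm_charFun_map_sub_le {Ω : Type*} [MeasurableSpace Ω] {μ : Measure Ω}
    [IsProbabilityMeasure μ] {X Y : Ω → ℝ} (hX : AEMeasurable X μ) (hY : AEMeasurable Y μ)
    (hXY : MemLp (fun ω ↦ X ω - Y ω) 2 μ) (t : ℝ) :
    ‖charFun (μ.map X) t - charFun (μ.map Y) t‖ ≤ |t| * √(∫ ω, (X ω - Y ω) ^ 2 ∂μ) := by
  have hint : ∀ {W : Ω → ℝ}, AEMeasurable W μ →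
      Integrable (fun ω ↦ Complex.exp ((t : ℂ) * (W ω : ℂ) * Complex.I)) μ := by
    intro W hW
    refine (integrable_const (1 : ℝ)).mono' (by fun_prop) (.of_forall fun ω ↦ ?_)
    rw [← Complex.ofReal_mul, Complex.norm_exp_ofReal_mul_I]
  rw [charFun_apply_real, charFun_apply_real, integral_map hX (by fun_prop),
    integral_map hY (by fun_prop), ← integral_sub (hint hX) (hint hY)]
  have hbd : ∀ ω, ‖Complex.exp ((t : ℂ) * (X ω : ℂ) * Complex.I) -
      Complex.exp ((t : ℂ) * (Y ω : ℂ) * Complex.I)‖ ≤ |t| * |X ω - Y ω| := by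
    intro ω
    have : Complex.exp ((t : ℂ) * (X ω : ℂ) * Complex.I) -
        Complex.exp ((t : ℂ) * (Y ω : ℂ) * Complex.I) =
        Complex.exp ((t * Y ω : ℝ) * Complex.I) *
          (Complex.exp (Complex.I * (t * (X ω - Y ω) : ℝ)) - 1) := by
      rw [mul_sub, ← Complex.exp_add, mul_one]
      congr 2 <;> push_cast <;> ring
    rw [this, norm_mul, Complex.norm_exp_ofReal_mul_I, one_mul, ← abs_mul]
    exact Real.norm_exp_I_mul_ofReal_sub_one_le
  have hi : Integrable (fun ω ↦ |X ω - Y ω|) μ := (hXY.integrable (by norm_num)).abs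
  calc _ ≤ ∫ ω, |t| * |X ω - Y ω| ∂μ :=
        norm_integral_le_of_norm_le (hi.const_mul _) (.of_forall hbd)
    _ = |t| * ∫ ω, |X ω - Y ω| ∂μ := integral_const_mul _ _
    _ ≤ _ := by
      gcongr
      refine Real.le_sqrt_of_sq_le ?_
      have := sq_integral_le (X := fun ω ↦ |X ω - Y ω|) hXY.abs
      simpa only [sq_abs] using this

/-- The quadratic bound serves for large values of `w`, the cubic bound for small ones. -/
theorem norm_exp_mul_I_sub_taylor_two_le (w : ℝ) :
    ‖Complex.exp (w * Complex.I) - (1 + w * Complex.I - w ^ 2 / 2)‖ ≤ 4 * w ^ 2 ∧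
    ‖Complex.exp (w * Complex.I) - (1 + w * Complex.I - w ^ 2 / 2)‖ ≤ 4 * |w| ^ 3 := by
  rcases le_or_gt |w| 1 with h | h
  · have h1 : ‖(w * Complex.I : ℂ)‖ = |w| := by simp
    have key := Complex.exp_bound (x := w * Complex.I) (by rw [h1]; exact h) (n := 3) (by norm_num)
    have h2 : ∑ m ∈ Finset.range 3, (w * Complex.I : ℂ) ^ m / (m.factorial : ℂ) =
        1 + w * Complex.I - w ^ 2 / 2 := by
      simp [Finset.sum_range_succ, mul_pow, Nat.factorial]
      ring
    rw [h2, h1] at key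
    have h3 : ‖Complex.exp (w * Complex.I) - (1 + w * Complex.I - w ^ 2 / 2)‖ ≤ |w| ^ 3 := by
      refine key.trans ?_
      have : (0 : ℝ) ≤ |w| ^ 3 := by positivity
      norm_num [Nat.factorial]
      linarith
    have h4 : |w| ^ 3 ≤ w ^ 2 := by
      rw [← sq_abs w, pow_succ]
      exact mul_le_of_le_one_right (by positivity) h
    have : (0 : ℝ) ≤ |w| ^ 3 := by positivity
    constructor <;> nlinarith [sq_nonneg w]
  · have h3 : ‖Complex.exp (w * Complex.I) - (1 + w * Complex.I - w ^ 2 / 2)‖ ≤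
        1 + (1 + |w| + w ^ 2 / 2) := by
      refine (norm_sub_le _ _).trans ?_
      rw [Complex.norm_exp_ofReal_mul_I]
      gcongr
      refine (norm_sub_le _ _).trans (add_le_add ((norm_add_le _ _).trans ?_) ?_)
      · simp
      · simp
    have h4 : |w| ≤ w ^ 2 := by rw [← sq_abs w]; nlinarith
    have h5 : w ^ 2 ≤ |w| ^ 3 := by
      rw [← sq_abs w, pow_succ _ 2]
      exact le_mul_of_one_le_right (by positivity) h.le
    constructor <;> nlinarith

/-- Second-order expansion of a characteristic function with an error that is explicit in the law:
the values up to `L` enter through a cubic term, those above through the tail of the second moment. -/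
theorem norm_charFun_map_sub_taylor_two_le {α : Type*} [MeasurableSpace α] {D : Measure α}
    [IsProbabilityMeasure D] {X : α → ℝ} (hX : Measurable X) (hX2 : MemLp X 2 D)
    (h0 : ∫ x, X x ∂D = 0) {L : ℝ} (hL : 0 ≤ L) (u : ℝ) :
    ‖charFun (D.map X) u - (1 - u ^ 2 * (∫ x, X x ^ 2 ∂D) / 2 : ℝ)‖ ≤
      4 * |u| ^ 3 * L * (∫ x, X x ^ 2 ∂D) +
        4 * u ^ 2 * ∫ x, {x | L < |X x|}.indicator (fun x ↦ X x ^ 2) x ∂D := by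
  have hs : MeasurableSet {x | L < |X x|} := measurableSet_lt measurable_const hX.abs
  have hi2 : Integrable (fun x ↦ X x ^ 2) D := hX2.integrable_sq
  have hi1 : Integrable X D := hX2.integrable (by norm_num)
  have hie : Integrable (fun x ↦ Complex.exp ((u * X x : ℝ) * Complex.I)) D := by
    refine (integrable_const (1 : ℝ)).mono' (by fun_prop) (.of_forall fun ω ↦ ?_)
    rw [Complex.norm_exp_ofReal_mul_I]
  have hiT : Integrable (fun x ↦ (1 + (u * X x : ℝ) * Complex.I - ((u * X x : ℝ) : ℂ) ^ 2 / 2)) D := by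
    refine ((integrable_const _).add ((hi1.const_mul u).ofReal.mul_const _)).sub
      (Integrable.div_const ?_ _)
    have := (hi2.const_mul (u ^ 2)).ofReal (𝕜 := ℂ)
    refine this.congr (.of_forall fun x ↦ ?_)
    simp [mul_pow]
  have hT : ∫ x, (1 + (u * X x : ℝ) * Complex.I - ((u * X x : ℝ) : ℂ) ^ 2 / 2) ∂D =
      ((1 - u ^ 2 * (∫ x, X x ^ 2 ∂D) / 2 : ℝ) : ℂ) := by
    have e1 : ∀ x, (1 + (u * X x : ℝ) * Complex.I - ((u * X x : ℝ) : ℂ) ^ 2 / 2) =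
        ((1 - u ^ 2 * X x ^ 2 / 2 : ℝ) : ℂ) + ((u * X x : ℝ) : ℂ) * Complex.I := by
      intro x; push_cast; ring
    simp_rw [e1]
    rw [integral_add (((integrable_const _).sub ((hi2.const_mul _).div_const _)).ofReal)
      ((hi1.const_mul u).ofReal.mul_const _), integral_mul_const, integral_complex_ofReal, integral_complex_ofReal,
      integral_const_mul, h0, integral_sub (integrable_const _) ((hi2.const_mul _).div_const _),
      integral_div, integral_const_mul]
    simp
  have hc : charFun (D.map X) u = ∫ x, Complex.exp ((u * X x : ℝ) * Complex.I) ∂D := by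
    rw [charFun_apply_real, integral_map hX.aemeasurable (by fun_prop)]
    simp
  rw [hc, ← hT, ← integral_sub hie hiT]
  have hbd : ∀ x, ‖Complex.exp ((u * X x : ℝ) * Complex.I) -
      (1 + (u * X x : ℝ) * Complex.I - ((u * X x : ℝ) : ℂ) ^ 2 / 2)‖ ≤
      4 * |u| ^ 3 * L * X x ^ 2 +
        4 * u ^ 2 * {x | L < |X x|}.indicator (fun x ↦ X x ^ 2) x := by
    intro x
    obtain ⟨k1, k2⟩ := norm_exp_mul_I_sub_taylor_two_le (u * X x)
    by_cases hx : L < |X x|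
    · rw [Set.indicator_of_mem (by exact hx)]
      have : (0 : ℝ) ≤ 4 * |u| ^ 3 * L * X x ^ 2 := by positivity
      rw [mul_pow] at k1
      linarith
    · rw [Set.indicator_of_notMem (by exact hx)]
      refine k2.trans ?_
      push Not at hx
      rw [abs_mul, mul_pow, pow_succ |X x| 2, sq_abs]
      have : (0 : ℝ) ≤ |u| ^ 3 * X x ^ 2 := by positivity
      nlinarith
  refine (norm_integral_le_of_norm_le ?_ (.of_forall hbd)).trans (le_of_eq ?_)
  · exact (hi2.const_mul _).add ((hi2.indicator hs).const_mul _)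
  · rw [integral_add (hi2.const_mul _) ((hi2.indicator hs).const_mul _), integral_const_mul,
      integral_const_mul]

/-- Powers of complex numbers in the unit disc that agree with `1 - x n` up to `o(1 / m n)`
converge as the powers of `exp (-x n)` do. -/
theorem tendsto_pow_of_tendsto_mul_norm_sub {φ : ℕ → ℂ} {x : ℕ → ℝ} {m : ℕ → ℕ} {y : ℝ}
    (hm : Tendsto m atTop atTop) (hφ : ∀ᶠ n in atTop, ‖φ n‖ ≤ 1) (hx0 : ∀ᶠ n in atTop, 0 ≤ x n)
    (hx : Tendsto (fun n ↦ m n * x n) atTop (𝓝 y))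
    (h : Tendsto (fun n ↦ m n * ‖φ n - (1 - x n : ℝ)‖) atTop (𝓝 0)) :
    Tendsto (fun n ↦ φ n ^ m n) atTop (𝓝 (Real.exp (-y) : ℝ)) := by
  have hmR : Tendsto (fun n ↦ (m n : ℝ)) atTop atTop := tendsto_natCast_atTop_atTop.comp hm
  have h1 : Tendsto (fun n ↦ ((Real.exp (-x n) : ℝ) : ℂ) ^ m n) atTop
      (𝓝 (Real.exp (-y) : ℝ)) := by
    have : ∀ n, ((Real.exp (-x n) : ℝ) : ℂ) ^ m n = ((Real.exp (-(m n * x n)) : ℝ) : ℂ) := by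
      intro n
      rw [← Complex.ofReal_pow, ← Real.exp_nat_mul]
      congr 2; ring
    simp_rw [this]
    exact (Complex.continuous_ofReal.tendsto _).comp
      ((Real.continuous_exp.tendsto _).comp hx.neg)
  have hxz : Tendsto x atTop (𝓝 0) := by
    have := hx.mul (tendsto_inv_atTop_zero.comp hmR)
    rw [mul_zero] at this
    refine this.congr' ?_
    filter_upwards [hm.eventually_gt_atTop 0] with n hn
    have : (m n : ℝ) ≠ 0 := by positivity
    simp only [Function.comp]
    field_simp
  have h2 : Tendsto (fun n ↦ m n * ‖φ n - (1 - x n : ℝ)‖ + (m n * x n) * x n) atTop (𝓝 0) := by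
    simpa using h.add (hx.mul hxz)
  have h3 : Tendsto (fun n ↦ φ n ^ m n - ((Real.exp (-x n) : ℝ) : ℂ) ^ m n) atTop (𝓝 0) := by
    refine squeeze_zero_norm' ?_ h2
    filter_upwards [hφ, hx0, hxz.eventually_le_const (show (0 : ℝ) < 1 by norm_num)]
      with n h4 h5 h6
    have h7 : ‖((Real.exp (-x n) : ℝ) : ℂ)‖ ≤ 1 := by
      rw [Complex.norm_real, Real.norm_eq_abs, Real.abs_exp]
      exact Real.exp_le_one_iff.2 (by linarith)
    have h8 : ‖((1 - x n : ℝ) : ℂ) - ((Real.exp (-x n) : ℝ) : ℂ)‖ ≤ x n * x n := by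
      rw [← Complex.ofReal_sub, Complex.norm_real, Real.norm_eq_abs, abs_sub_comm]
      have := Real.abs_exp_sub_one_sub_id_le (x := -x n) (by rwa [abs_neg, abs_of_nonneg h5])
      rw [show Real.exp (-x n) - (1 - x n) = Real.exp (-x n) - 1 - -x n by ring]
      refine this.trans (le_of_eq (by ring))
    have h9 : ‖φ n ^ m n - ((Real.exp (-x n) : ℝ) : ℂ) ^ m n‖ ≤
        m n * ‖φ n - ((Real.exp (-x n) : ℝ) : ℂ)‖ := by
      rw [← (Commute.all (φ n) _).mul_geom_sum₂, norm_mul, mul_comm]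
      gcongr
      refine (norm_sum_le _ _).trans ?_
      calc _ ≤ ∑ i ∈ Finset.range (m n), (1 : ℝ) := by
            refine Finset.sum_le_sum fun i _ ↦ ?_
            rw [norm_mul, norm_pow, norm_pow]
            exact mul_le_one₀ (pow_le_one₀ (norm_nonneg _) h4) (by positivity)
              (pow_le_one₀ (norm_nonneg _) h7)
        _ = m n := by simp
    refine h9.trans ?_
    have h10 : ‖φ n - ((Real.exp (-x n) : ℝ) : ℂ)‖ ≤
        ‖φ n - (1 - x n : ℝ)‖ + x n * x n :=
      (norm_sub_le_norm_sub_add_norm_sub _ _ _).trans (by gcongr)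
    calc (m n : ℝ) * ‖φ n - ((Real.exp (-x n) : ℝ) : ℂ)‖ ≤
        m n * (‖φ n - (1 - x n : ℝ)‖ + x n * x n) := by gcongr
      _ = _ := by ring
  simpa using h3.add h1

/-- The central limit theorem for triangular arrays whose rows are i.i.d.: `(D n, a n)` gives the law
of one summand in row `n`, which is centred here by its own mean. -/
theorem tendsto_charFun_pow_of_lindeberg {α : ℕ → Type*} [∀ n, MeasurableSpace (α n)]
    {D : (n : ℕ) → Measure (α n)} (hD : ∀ᶠ n in atTop, IsProbabilityMeasure (D n))
    {a : (n : ℕ) → α n → ℝ} (ha : ∀ n, Measurable (a n)) (ha2 : ∀ n, MemLp (a n) 2 (D n))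
    (hmean : Tendsto (fun n ↦ ∫ x, a n x ∂(D n)) atTop (𝓝 0)) {v : ℝ}
    (hvar : Tendsto (fun n ↦ ∫ x, a n x ^ 2 ∂(D n)) atTop (𝓝 v))
    (htail : ∀ ε > 0, ∃ K > 0, ∀ᶠ n in atTop,
      ∫ x, {x | K < |a n x|}.indicator (fun x ↦ a n x ^ 2) x ∂(D n) ≤ ε)
    {m : ℕ → ℕ} (hm : Tendsto m atTop atTop) {c : ℕ → ℝ} {τ : ℝ}
    (hc : Tendsto (fun n ↦ m n * c n ^ 2) atTop (𝓝 τ)) (t : ℝ) :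
    Tendsto (fun n ↦
      charFun ((D n).map (fun x ↦ a n x - ∫ y, a n y ∂(D n))) (c n * t) ^ m n) atTop
      (𝓝 (Real.exp (-(τ * v * t ^ 2 / 2)) : ℝ)) := by
  set μ : ℕ → ℝ := fun n ↦ ∫ x, a n x ∂(D n) with hμ
  set X : (n : ℕ) → α n → ℝ := fun n x ↦ a n x - μ n with hXdef
  set w : ℕ → ℝ := fun n ↦ ∫ x, X n x ^ 2 ∂(D n) with hw
  have hmR : Tendsto (fun n ↦ (m n : ℝ)) atTop atTop := tendsto_natCast_atTop_atTop.comp hm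
  have hXm : ∀ n, Measurable (X n) := fun n ↦ (ha n).sub_const _
  have hwv : Tendsto w atTop (𝓝 v) := by
    have := hvar.sub (hmean.pow 2)
    rw [zero_pow two_ne_zero, sub_zero] at this
    refine this.congr' ?_
    filter_upwards [hD] with n hn
    exact (integral_sub_integral_sq (ha2 n)).symm
  have hc0 : Tendsto (fun n ↦ |c n|) atTop (𝓝 0) := by
    have h1 : Tendsto (fun n ↦ c n ^ 2) atTop (𝓝 0) := by
      have := hc.mul (tendsto_inv_atTop_zero.comp hmR)
      rw [mul_zero] at this
      refine this.congr' ?_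
      filter_upwards [hm.eventually_gt_atTop 0] with n hn
      have : (m n : ℝ) ≠ 0 := by positivity
      simp only [Function.comp]
      field_simp
    have := (Real.continuous_sqrt.tendsto _).comp h1
    rw [Real.sqrt_zero] at this
    exact this.congr fun n ↦ Real.sqrt_sq_eq_abs _
  refine tendsto_pow_of_tendsto_mul_norm_sub (x := fun n ↦ (c n * t) ^ 2 * w n / 2) hm ?_ ?_ ?_ ?_
  · filter_upwards [hD] with n hn
    have := Measure.isProbabilityMeasure_map (μ := D n) (hXm n).aemeasurable
    exact norm_charFun_le_one _
  · refine .of_forall fun n ↦ ?_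
    have : 0 ≤ w n := integral_nonneg fun _ ↦ sq_nonneg _
    positivity
  · have := ((hc.mul hwv).mul_const (t ^ 2)).div_const 2
    exact this.congr fun n ↦ by ring
  · have hlim : ∀ L : ℝ, Tendsto (fun n ↦ m n * (4 * |c n * t| ^ 3 * L * w n)) atTop (𝓝 0) := by
      intro L
      have := ((hc.mul hc0).mul hwv).mul_const (4 * |t| ^ 3 * L)
      simp only [mul_zero, zero_mul] at this
      refine this.congr fun n ↦ ?_
      rw [abs_mul, mul_pow, pow_succ |c n| 2, sq_abs]
      ring
    rw [Metric.tendsto_atTop']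
    simp only [dist_zero_right]
    suffices hs : ∀ ε > 0, ∀ᶠ n in atTop,
        ‖(m n : ℝ) * ‖charFun ((D n).map (X n)) (c n * t) -
          (1 - (c n * t) ^ 2 * w n / 2 : ℝ)‖‖ < ε by
      intro ε hε
      obtain ⟨N, hN⟩ := eventually_atTop.1 (hs ε hε)
      exact ⟨N, fun n hn ↦ hN n hn.le⟩
    intro ε hε
    have hτ : 0 ≤ τ := ge_of_tendsto' hc fun n ↦ by positivity
    set B : ℝ := (τ + 1) * t ^ 2 * 16 + 1 with hB
    have hBpos : 0 < B := by positivity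
    -- `B` makes the tail term `(B - 1) / B * (ε / 2)`, leaving `ε / 2` for the cubic term
    obtain ⟨K, hK, hKε⟩ := htail (ε / (2 * B)) (by positivity)
    filter_upwards [hD, hKε, hmean.abs.eventually_le_const (show |(0 : ℝ)| < K by simpa using hK),
      (hlim (2 * K)).eventually_lt_const (show (0 : ℝ) < ε / 2 by positivity),
      hc.eventually_le_const (show τ < τ + 1 by linarith)] with n h1 h2 h3 h4 h5
    have hX2 : MemLp (X n) 2 (D n) := (ha2 n).sub (memLp_const _)
    have h0 : ∫ x, X n x ∂(D n) = 0 := by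
      rw [hXdef]
      simp only
      rw [integral_sub ((ha2 n).integrable (by norm_num)) (integrable_const _)]
      simp [hμ]
    have key := norm_charFun_map_sub_taylor_two_le (hXm n) hX2 h0 (L := 2 * K) (by positivity)
      (c n * t)
    -- where `|a - mean| > 2 K` and `|mean| ≤ K`, one has `|a| > K` and `|a - mean| ≤ 2 |a|`
    have htl : ∫ x, {x | 2 * K < |X n x|}.indicator (fun x ↦ X n x ^ 2) x ∂(D n) ≤
        4 * (ε / (2 * B)) := by
      refine le_trans ?_ (mul_le_mul_of_nonneg_left h2 (by norm_num))
      rw [← integral_const_mul]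
      refine integral_mono ?_ ?_ ?_
      · exact hX2.integrable_sq.indicator (measurableSet_lt measurable_const (hXm n).abs)
      · exact ((ha2 n).integrable_sq.indicator
          (measurableSet_lt measurable_const (ha n).abs)).const_mul _
      · intro x
        by_cases hx : 2 * K < |X n x|
        · have h6 : |X n x| ≤ |a n x| + |μ n| := abs_sub _ _
          have h7 : K < |a n x| := by linarith
          simp only
          rw [Set.indicator_of_mem (by exact hx), Set.indicator_of_mem (by exact h7),
            ← sq_abs (X n x), ← sq_abs (a n x)]
          nlinarith [abs_nonneg (X n x), abs_nonneg (a n x)]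
        · simp only
          rw [Set.indicator_of_notMem (by exact hx)]
          exact mul_nonneg (by norm_num) (Set.indicator_nonneg (fun _ _ ↦ sq_nonneg _) _)
    rw [Real.norm_of_nonneg (by positivity)]
    calc (m n : ℝ) * ‖charFun ((D n).map (X n)) (c n * t) -
          (1 - (c n * t) ^ 2 * w n / 2 : ℝ)‖
        ≤ m n * (4 * |c n * t| ^ 3 * (2 * K) * w n +
          4 * (c n * t) ^ 2 * (4 * (ε / (2 * B)))) := by
          refine mul_le_mul_of_nonneg_left (key.trans ?_) (by positivity)
          gcongr
      _ = m n * (4 * |c n * t| ^ 3 * (2 * K) * w n) +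
          (m n * c n ^ 2) * (t ^ 2 * 16 * (ε / (2 * B))) := by ring
      _ ≤ m n * (4 * |c n * t| ^ 3 * (2 * K) * w n) +
          (τ + 1) * (t ^ 2 * 16 * (ε / (2 * B))) := by gcongr
      _ = m n * (4 * |c n * t| ^ 3 * (2 * K) * w n) + (B - 1) / B * (ε / 2) := by
          rw [hB]; field_simp; ring
      _ < ε / 2 + 1 * (ε / 2) := by
          gcongr
          rw [div_lt_one hBpos]; linarith
      _ = ε := by ring

/-! ### Two-way averages with varying laws -/

theorem memLp_integral_prod_right {𝒵 𝒮 : Type*} [MeasurableSpace 𝒵] [MeasurableSpace 𝒮]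
    {D : Measure 𝒵} [IsProbabilityMeasure D] {M : Measure 𝒮} [IsProbabilityMeasure M]
    {r : 𝒵 × 𝒮 → ℝ} (hr : Measurable r) (hr2 : MemLp r 2 (D.prod M)) :
    MemLp (fun z ↦ ∫ s, r (z, s) ∂M) 2 D := by
  have hm : StronglyMeasurable fun z ↦ ∫ s, r (z, s) ∂M :=
    hr.stronglyMeasurable.integral_prod_right'
  rw [memLp_two_iff_integrable_sq hm.aestronglyMeasurable]
  refine hr2.integrable_sq.integral_prod_left.mono' (hm.pow 2).aestronglyMeasurable ?_
  filter_upwards [hr2.integrable_sq.prod_right_ae] with z hz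
  rw [Real.norm_of_nonneg (sq_nonneg _)]
  exact sq_integral_le ((memLp_two_iff_integrable_sq
    (hr.comp measurable_prodMk_left).aestronglyMeasurable).2 hz)

theorem integral_sq_integral_sub_le {𝒵 𝒮 : Type*} [MeasurableSpace 𝒵] [MeasurableSpace 𝒮]
    {D : Measure 𝒵} [IsProbabilityMeasure D] {M : Measure 𝒮} [IsProbabilityMeasure M]
    {r : 𝒵 × 𝒮 → ℝ} (hr : Measurable r) (hr2 : MemLp r 2 (D.prod M)) :
    ∫ z, (∫ s, (r (z, s) - ∫ q, r q ∂(D.prod M)) ∂M) ^ 2 ∂D ≤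
      ∫ z, (∫ s, r (z, s) ∂M) ^ 2 ∂D := by
  have hi : Integrable r (D.prod M) := hr2.integrable (by norm_num)
  have h1 : ∫ z, (∫ s, (r (z, s) - ∫ q, r q ∂(D.prod M)) ∂M) ^ 2 ∂D =
      ∫ z, ((∫ s, r (z, s) ∂M) - ∫ z', (∫ s, r (z', s) ∂M) ∂D) ^ 2 ∂D := by
    refine integral_congr_ae ?_
    filter_upwards [hi.prod_right_ae] with z hz
    rw [integral_sub hz (integrable_const _), integral_prod _ hi]
    simp
  rw [h1, integral_sub_integral_sq (memLp_integral_prod_right hr hr2)]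
  linarith [sq_nonneg (∫ z', (∫ s, r (z', s) ∂M) ∂D)]

theorem charFun_map_sum_of_iIndepFun {Ω 𝒵 ι : Type*} [Fintype ι] [MeasurableSpace Ω]
    [MeasurableSpace 𝒵] {P : Measure Ω} [IsProbabilityMeasure P] {D : Measure 𝒵} {Z : ι → Ω → 𝒵}
    (hZ : ∀ i, Measurable (Z i)) (hlaw : ∀ i, P.map (Z i) = D) (hind : iIndepFun Z P)
    {φ : 𝒵 → ℝ} (hφ : Measurable φ) (c t : ℝ) :
    charFun (P.map (fun ω ↦ ∑ i, c * φ (Z i ω))) t =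
      charFun (D.map φ) (c * t) ^ Fintype.card ι := by
  have hind' : iIndepFun (fun i ω ↦ c * φ (Z i ω)) P :=
    hind.comp (fun _ z ↦ c * φ z) fun _ ↦ hφ.const_mul c
  rw [hind'.charFun_map_fun_sum_eq_prod fun i ↦
      (show Measurable fun ω ↦ c * φ (Z i ω) from (hφ.comp (hZ i)).const_mul c).aemeasurable,
    Finset.prod_apply]
  have : ∀ i, charFun (P.map (fun ω ↦ c * φ (Z i ω))) t = charFun (D.map φ) (c * t) := by
    intro i
    rw [charFun_map_mul_comp (f := fun ω ↦ φ (Z i ω)) (hφ.comp (hZ i)).aemeasurable, ← hlaw i, Measure.map_map hφ (hZ i)]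
    rfl
  simp [this]

/-- The characteristic function of a two-way average of `a + b + r` differs from that of the two
independent one-way sums of `a` and `b` by at most the `L²` norm of the contribution of `r`. -/
theorem TwoWayIID.norm_charFun_map_sub_le {Ω 𝒵 𝒮 : Type*} [MeasurableSpace Ω] [MeasurableSpace 𝒵]
    [MeasurableSpace 𝒮] {P : Measure Ω} [IsProbabilityMeasure P] {D : Measure 𝒵}
    [IsProbabilityMeasure D] {M : Measure 𝒮} [IsProbabilityMeasure M] {m k : ℕ}
    {Z : Fin m → Ω → 𝒵} {S : Fin k → Ω → 𝒮} (h : TwoWayIID P D M Z S)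
    (hm : 0 < m) (hk : 0 < k) {a : 𝒵 → ℝ} {b : 𝒮 → ℝ} {r : 𝒵 × 𝒮 → ℝ}
    (ha : Measurable a) (hb : Measurable b) (hr : Measurable r)
    (hr2 : MemLp r 2 (D.prod M)) (c t : ℝ) :
    ‖charFun (P.map fun ω ↦ c * ((1 / (k : ℝ)) * ∑ j, (1 / (m : ℝ)) * ∑ i,
          (a (Z i ω) + b (S j ω) + r (Z i ω, S j ω)) -
          (∫ z, a z ∂D + ∫ s, b s ∂M + ∫ q, r q ∂(D.prod M)))) t -
        charFun (D.map fun z ↦ a z - ∫ z', a z' ∂D) (c / m * t) ^ m *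
          charFun (M.map fun s ↦ b s - ∫ s', b s' ∂M) (c / k * t) ^ k‖ ≤
      |t| * √(c ^ 2 * (1 / (m * k) * ∫ q, r q ^ 2 ∂(D.prod M) +
        1 / m * ∫ z, (∫ s, r (z, s) ∂M) ^ 2 ∂D + 1 / k * ∫ s, (∫ z, r (z, s) ∂D) ^ 2 ∂M)) := by
  set α := ∫ z, a z ∂D with hα
  set β := ∫ s, b s ∂M with hβ
  set ρ := ∫ q, r q ∂(D.prod M) with hρ
  have hm0 : (m : ℝ) ≠ 0 := by positivity
  have hk0 : (k : ℝ) ≠ 0 := by positivity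
  have hZ := h.measurable_left
  have hS := h.measurable_right
  have ha' : Measurable fun z ↦ a z - α := ha.sub_const α
  have hb' : Measurable fun s ↦ b s - β := hb.sub_const β
  have hr' : Measurable fun q ↦ r q - ρ := hr.sub_const ρ
  have hr2' : MemLp (fun q ↦ r q - ρ) 2 (D.prod M) := hr2.sub (memLp_const _)
  have hrint : Integrable r (D.prod M) := hr2.integrable (by norm_num)
  have hr0 : ∫ q, (r q - ρ) ∂(D.prod M) = 0 := by
    rw [integral_sub hrint (integrable_const _)]; simp [hρ]
  set T := fun ω ↦ c * ((1 / (k : ℝ)) * ∑ j, (1 / (m : ℝ)) * ∑ i,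
    (a (Z i ω) + b (S j ω) + r (Z i ω, S j ω)) - (α + β + ρ)) with hT
  set U := fun ω ↦ ∑ i, c / m * (a (Z i ω) - α) with hU
  set V := fun ω ↦ ∑ j, c / k * (b (S j ω) - β) with hV
  have hUm : Measurable U := Finset.measurable_sum _ fun i _ ↦ (ha'.comp (hZ i)).const_mul _
  have hVm : Measurable V := Finset.measurable_sum _ fun i _ ↦ (hb'.comp (hS i)).const_mul _
  have hTm : Measurable T := by
    have : ∀ i j, Measurable fun ω ↦ a (Z i ω) + b (S j ω) + r (Z i ω, S j ω) := fun i j ↦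
      ((ha.comp (hZ i)).add (hb.comp (hS j))).add (hr.comp (h.measurable_pair i j))
    fun_prop
  have hUV : IndepFun U V P :=
    h.indep.comp (φ := fun z : Fin m → 𝒵 ↦ ∑ i, c / m * (a (z i) - α))
      (ψ := fun s : Fin k → 𝒮 ↦ ∑ j, c / k * (b (s j) - β))
      (Finset.measurable_sum _ fun i _ ↦ (ha'.comp (measurable_pi_apply i)).const_mul _)
      (Finset.measurable_sum _ fun i _ ↦ (hb'.comp (measurable_pi_apply i)).const_mul _)
  have hcf : charFun (P.map fun ω ↦ U ω + V ω) t =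
      charFun (D.map fun z ↦ a z - α) (c / m * t) ^ m *
        charFun (M.map fun s ↦ b s - β) (c / k * t) ^ k := by
    rw [hUV.charFun_map_fun_add_eq_mul hUm.aemeasurable hVm.aemeasurable, Pi.mul_apply,
      charFun_map_sum_of_iIndepFun hZ h.law_left h.indep_left ha',
      charFun_map_sum_of_iIndepFun hS h.law_right h.indep_right hb']
    simp
  -- the main effects cancel exactly, and only the centred remainder is left
  have hdiff : ∀ ω, T ω - (U ω + V ω) =
      c / (m * k) * ∑ i, ∑ j, (r (Z i ω, S j ω) - ρ) := by
    intro ω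
    rw [Finset.sum_comm (f := fun i j ↦ r (Z i ω, S j ω) - ρ)]
    simp only [hT, hU, hV, ← Finset.mul_sum, Finset.sum_add_distrib, Finset.sum_sub_distrib,
      Finset.sum_const, Finset.card_univ, Fintype.card_fin, nsmul_eq_mul]
    field_simp
    ring
  have hmem : MemLp (fun ω ↦ T ω - (U ω + V ω)) 2 P := by
    simp_rw [hdiff]
    exact (memLp_finsetSum _ fun i _ ↦ memLp_finsetSum _ fun j _ ↦
      h.memLp_kernel hr2' i j).const_mul _
  rw [← hcf]
  refine (MultiBootstrap.norm_charFun_map_sub_le hTm.aemeasurable (hUm.add hVm).aemeasurable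
    hmem t).trans ?_
  refine mul_le_mul_of_nonneg_left (Real.sqrt_le_sqrt ?_) (abs_nonneg t)
  rw [integral_congr_ae (.of_forall fun ω ↦ show (T ω - (U + V) ω) ^ 2 =
    (c / (m * k)) ^ 2 * (∑ i, ∑ j, (r (Z i ω, S j ω) - ρ)) ^ 2 by
      rw [Pi.add_apply, hdiff, mul_pow])]
  rw [integral_const_mul]
  have key := h.integral_sq_sum_sum_le hr' hr2' hr0 Finset.univ Finset.univ
  simp only [Finset.card_univ, Fintype.card_fin] at key
  have e0 : ∫ q, (r q - ρ) ^ 2 ∂(D.prod M) ≤ ∫ q, r q ^ 2 ∂(D.prod M) := by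
    rw [integral_sub_integral_sq hr2]
    linarith [sq_nonneg (∫ q, r q ∂(D.prod M))]
  have e1 : ∫ z, (∫ s, (r (z, s) - ρ) ∂M) ^ 2 ∂D ≤ ∫ z, (∫ s, r (z, s) ∂M) ^ 2 ∂D := by
    exact integral_sq_integral_sub_le hr hr2
  have e2 : ∫ s, (∫ z, (r (z, s) - ρ) ∂D) ^ 2 ∂M ≤ ∫ s, (∫ z, r (z, s) ∂D) ^ 2 ∂M := by
    have := integral_sq_integral_sub_le (hr.comp measurable_swap)
      (hr2.comp_measurePreserving (Measure.measurePreserving_swap (μ := M) (ν := D)))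
    simp only [Function.comp, Prod.swap_prod_mk] at this
    rwa [integral_prod_swap (f := r)] at this
  calc _ ≤ (c / (m * k)) ^ 2 * (m * k * ∫ q, r q ^ 2 ∂(D.prod M) +
        m * (k : ℝ) ^ 2 * ∫ z, (∫ s, r (z, s) ∂M) ^ 2 ∂D +
        (m : ℝ) ^ 2 * k * ∫ s, (∫ z, r (z, s) ∂D) ^ 2 ∂M) := by
        refine mul_le_mul_of_nonneg_left (key.trans ?_) (by positivity)
        gcongr
    _ = _ := by field_simp

/-- The central limit theorem for two-way averages with laws and kernels that depend on `n`. The laws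
are only required to be probability measures eventually, because the uniform law on an empty sample
is the zero measure. -/
theorem tendsto_charFun_of_twoWayIID {Ω : Type*} [MeasurableSpace Ω] {P : Measure Ω}
    [IsProbabilityMeasure P] {α β : ℕ → Type*} [∀ n, MeasurableSpace (α n)]
    [∀ n, MeasurableSpace (β n)] {D : (n : ℕ) → Measure (α n)} {M : (n : ℕ) → Measure (β n)}
    (hD : ∀ᶠ n in atTop, IsProbabilityMeasure (D n))
    (hM : ∀ᶠ n in atTop, IsProbabilityMeasure (M n))
    {m k : ℕ → ℕ} (hm : Tendsto m atTop atTop) (hk : Tendsto k atTop atTop)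
    {Z : (n : ℕ) → Fin (m n) → Ω → α n} {S : (n : ℕ) → Fin (k n) → Ω → β n}
    (h : ∀ n, TwoWayIID P (D n) (M n) (Z n) (S n))
    {a : (n : ℕ) → α n → ℝ} {b : (n : ℕ) → β n → ℝ} {r : (n : ℕ) → α n × β n → ℝ}
    (ha : ∀ n, Measurable (a n)) (hb : ∀ n, Measurable (b n)) (hr : ∀ n, Measurable (r n))
    (ha2 : ∀ n, MemLp (a n) 2 (D n)) (hb2 : ∀ n, MemLp (b n) 2 (M n))
    (hr2 : ∀ n, MemLp (r n) 2 ((D n).prod (M n)))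
    (hamean : Tendsto (fun n ↦ ∫ x, a n x ∂(D n)) atTop (𝓝 0)) {va : ℝ}
    (havar : Tendsto (fun n ↦ ∫ x, a n x ^ 2 ∂(D n)) atTop (𝓝 va))
    (hatail : ∀ ε > 0, ∃ K > 0, ∀ᶠ n in atTop,
      ∫ x, {x | K < |a n x|}.indicator (fun x ↦ a n x ^ 2) x ∂(D n) ≤ ε)
    (hbmean : Tendsto (fun n ↦ ∫ x, b n x ∂(M n)) atTop (𝓝 0)) {vb : ℝ}
    (hbvar : Tendsto (fun n ↦ ∫ x, b n x ^ 2 ∂(M n)) atTop (𝓝 vb))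
    (hbtail : ∀ ε > 0, ∃ K > 0, ∀ᶠ n in atTop,
      ∫ x, {x | K < |b n x|}.indicator (fun x ↦ b n x ^ 2) x ∂(M n) ≤ ε)
    {c : ℕ → ℝ} {τa τb : ℝ} (hca : Tendsto (fun n ↦ c n ^ 2 / m n) atTop (𝓝 τa))
    (hcb : Tendsto (fun n ↦ c n ^ 2 / k n) atTop (𝓝 τb))
    (hr0 : Tendsto (fun n ↦ 1 / (m n : ℝ) * ∫ q, r n q ^ 2 ∂((D n).prod (M n))) atTop (𝓝 0))
    (hr1 : Tendsto (fun n ↦ ∫ z, (∫ s, r n (z, s) ∂(M n)) ^ 2 ∂(D n)) atTop (𝓝 0))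
    (hr2' : Tendsto (fun n ↦ ∫ s, (∫ z, r n (z, s) ∂(D n)) ^ 2 ∂(M n)) atTop (𝓝 0)) (t : ℝ) :
    Tendsto (fun n ↦ charFun (P.map fun ω ↦ c n * ((1 / (k n : ℝ)) * ∑ j, (1 / (m n : ℝ)) * ∑ i,
          (a n (Z n i ω) + b n (S n j ω) + r n (Z n i ω, S n j ω)) -
          (∫ z, a n z ∂(D n) + ∫ s, b n s ∂(M n) + ∫ q, r n q ∂((D n).prod (M n))))) t) atTop
      (𝓝 (Real.exp (-((τa * va + τb * vb) * t ^ 2 / 2)) : ℝ)) := by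
  have hA := tendsto_charFun_pow_of_lindeberg hD ha ha2 hamean havar hatail hm
    (c := fun n ↦ c n / m n) (τ := τa) (hca.congr' ?_) t
  · have hB := tendsto_charFun_pow_of_lindeberg hM hb hb2 hbmean hbvar hbtail hk
      (c := fun n ↦ c n / k n) (τ := τb) (hcb.congr' ?_) t
    · have hAB := hA.mul hB
      have herr : Tendsto (fun n ↦ |t| * √(c n ^ 2 * (1 / (m n * k n) *
          ∫ q, r n q ^ 2 ∂((D n).prod (M n)) +
          1 / m n * ∫ z, (∫ s, r n (z, s) ∂(M n)) ^ 2 ∂(D n) +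
          1 / k n * ∫ s, (∫ z, r n (z, s) ∂(D n)) ^ 2 ∂(M n)))) atTop (𝓝 0) := by
        have := (((hcb.mul hr0).add (hca.mul hr1)).add (hcb.mul hr2'))
        simp only [mul_zero, add_zero] at this
        have h2 := ((Real.continuous_sqrt.tendsto _).comp this).const_mul |t|
        rw [Real.sqrt_zero, mul_zero] at h2
        refine h2.congr fun n ↦ ?_
        simp only [Function.comp]
        congr 2
        ring
      have hd := squeeze_zero_norm' ((hD.and (hM.and ((hm.eventually_gt_atTop 0).and
        (hk.eventually_gt_atTop 0)))).mono fun n hn ↦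
          haveI := hn.1
          haveI := hn.2.1
          (h n).norm_charFun_map_sub_le hn.2.2.1 hn.2.2.2 (ha n) (hb n) (hr n)
            (hr2 n) (c n) t) herr
      have := hd.add hAB
      rw [zero_add] at this
      convert! this using 2
      · exact (sub_add_cancel _ _).symm
      · rw [← Complex.ofReal_mul, ← Real.exp_add]
        congr 3
        ring
    · filter_upwards [hk.eventually_gt_atTop 0] with n hn
      field_simp
  · filter_upwards [hm.eventually_gt_atTop 0] with n hn
    field_simp

/-! ### Almost sure convergence of two-way averages -/

/-- Nonnegative variables with summable means tend to zero almost surely. -/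
theorem ae_tendsto_zero_of_integral_le {Ω : Type*} [MeasurableSpace Ω] {P : Measure Ω}
    {U : ℕ → Ω → ℝ} (hU0 : ∀ m ω, 0 ≤ U m ω) (hUi : ∀ m, Integrable (U m) P) {C : ℝ}
    (hUC : ∀ m : ℕ, ∫ ω, U m ω ∂P ≤ C / ((m : ℝ) + 1) ^ 2) :
    ∀ᵐ ω ∂P, Tendsto (fun m ↦ U m ω) atTop (𝓝 0) := by
  have hsum : Summable fun m : ℕ ↦ C / ((m : ℝ) + 1) ^ 2 := by
    have := ((summable_nat_add_iff 1).2 (Real.summable_one_div_nat_pow.2 one_lt_two)).mul_left C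
    refine this.congr fun m ↦ ?_
    push_cast
    ring
  have hfin : ∫⁻ ω, ∑' m, ENNReal.ofReal (U m ω) ∂P ≠ ∞ := by
    rw [lintegral_tsum fun m ↦ (hUi m).1.aemeasurable.ennreal_ofReal]
    have h1 : ∀ m, ∫⁻ ω, ENNReal.ofReal (U m ω) ∂P ≤
        ENNReal.ofReal (C / ((m : ℝ) + 1) ^ 2) := fun m ↦ by
      rw [← ofReal_integral_eq_lintegral_ofReal (hUi m) (.of_forall (hU0 m))]
      exact ENNReal.ofReal_le_ofReal (hUC m)
    exact ne_top_of_le_ne_top hsum.tsum_ofReal_ne_top (ENNReal.tsum_le_tsum h1)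
  filter_upwards [ae_lt_top' (AEMeasurable.tsum fun m ↦
    (hUi m).1.aemeasurable.ennreal_ofReal) hfin] with ω hω
  have h2 := ENNReal.tendsto_atTop_zero_of_tsum_ne_top hω.ne
  have h3 := (ENNReal.tendsto_toReal ENNReal.zero_ne_top).comp h2
  refine h3.congr fun m ↦ ?_
  simp [ENNReal.toReal_ofReal (hU0 m ω)]

namespace TwoWayIID

variable {Ω 𝒵 𝒮 : Type*} [MeasurableSpace Ω] [MeasurableSpace 𝒵] [MeasurableSpace 𝒮]
  {P : Measure Ω} [IsProbabilityMeasure P] {D : Measure 𝒵} {M : Measure 𝒮} {Z : ℕ → Ω → 𝒵} {S : ℕ → Ω → 𝒮}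

/-- The mean of `r ^ 2` over the array is `o(n)` almost surely. Its expectation is constant, so along
squares the quotient has summable expectations, and the sums are monotone in the sample sizes. -/
theorem ae_tendsto_mean_sq_div (h : TwoWayIID P D M Z S) {r : 𝒵 × 𝒮 → ℝ} (hr : Measurable r)
    (hr2 : MemLp r 2 (D.prod M)) {nx ns : ℕ → ℕ} (hnx : ∀ n, nx n ≤ n) (hns : ∀ n, ns n ≤ n)
    {R : ℕ} (hRx : ∀ᶠ n in atTop, n ≤ R * nx n) (hRs : ∀ᶠ n in atTop, n ≤ R * ns n) :
    ∀ᵐ ω ∂P, Tendsto (fun n ↦ 1 / (nx n : ℝ) * (1 / ((nx n : ℝ) * ns n) *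
      ∑ i ∈ Finset.range (nx n), ∑ j ∈ Finset.range (ns n), r (Z i ω, S j ω) ^ 2))
      atTop (𝓝 0) := by
  set W : ℕ → Ω → ℝ := fun m ω ↦ 1 / ((m : ℝ) + 1) ^ 6 *
    ∑ i ∈ Finset.range ((m + 1) ^ 2), ∑ j ∈ Finset.range ((m + 1) ^ 2),
      r (Z i ω, S j ω) ^ 2 with hW
  have hi : ∀ i j, Integrable (fun ω ↦ r (Z i ω, S j ω) ^ 2) P := fun i j ↦
    (h.memLp_kernel hr2 i j).integrable_sq
  have hW0 : ∀ᵐ ω ∂P, Tendsto (fun m ↦ W m ω) atTop (𝓝 0) := by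
    refine ae_tendsto_zero_of_integral_le (C := ∫ q, r q ^ 2 ∂(D.prod M))
      (fun m ω ↦ by positivity) (fun m ↦ ?_) (fun m ↦ le_of_eq ?_)
    · exact (integrable_finsetSum _ fun i _ ↦ integrable_finsetSum _ fun j _ ↦ hi i j).const_mul _
    · simp only [hW]
      rw [integral_const_mul, integral_finsetSum _ fun i _ ↦ integrable_finsetSum _ fun j _ ↦ hi i j,
        Finset.sum_congr rfl fun i _ ↦ integral_finsetSum _ fun j _ ↦ hi i j]
      simp_rw [h.integral_kernel (g := fun q ↦ r q ^ 2) (hr.pow_const 2)]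
      simp
      field_simp
  filter_upwards [hW0] with ω hω
  have hsq : Tendsto Nat.sqrt atTop atTop :=
    tendsto_atTop.2 fun b ↦ (eventually_ge_atTop (b * b)).mono fun n hn ↦ Nat.le_sqrt.2 hn
  have hlim := (hω.comp hsq).const_mul (64 * (R : ℝ) ^ 3)
  rw [mul_zero] at hlim
  refine squeeze_zero' (.of_forall fun n ↦ by positivity) ?_ hlim
  filter_upwards [hRx, hRs, eventually_ge_atTop 1] with n h1 h2 h3
  simp only [Function.comp]
  set m := Nat.sqrt n with hm
  have hmn : m * m ≤ n := Nat.sqrt_le n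
  have hnm : n ≤ (m + 1) ^ 2 := by rw [sq]; exact (Nat.lt_succ_sqrt n).le
  have hm1 : 1 ≤ m := Nat.le_sqrt.2 (by omega)
  have hle : ∑ i ∈ Finset.range (nx n), ∑ j ∈ Finset.range (ns n), r (Z i ω, S j ω) ^ 2 ≤
      ((m : ℝ) + 1) ^ 6 * W m ω := by
    simp only [hW]
    rw [← mul_assoc, mul_one_div_cancel (by positivity), one_mul]
    refine (Finset.sum_le_sum fun i _ ↦ Finset.sum_le_sum_of_subset_of_nonneg
      (Finset.range_subset_range.2 ((hns n).trans hnm)) fun _ _ _ ↦ sq_nonneg _).trans ?_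
    exact Finset.sum_le_sum_of_subset_of_nonneg
      (Finset.range_subset_range.2 ((hnx n).trans hnm)) fun _ _ _ ↦
        Finset.sum_nonneg fun _ _ ↦ sq_nonneg _
  have hWn : 0 ≤ W m ω := by positivity
  have hnx0 : 0 < nx n := Nat.pos_of_ne_zero fun h0 ↦ by rw [h0] at h1; omega
  have hns0 : 0 < ns n := Nat.pos_of_ne_zero fun h0 ↦ by rw [h0] at h2; omega
  have h1' : (n : ℝ) ≤ R * nx n := by exact_mod_cast h1
  have h2' : (n : ℝ) ≤ R * ns n := by exact_mod_cast h2
  -- `(m + 1)² ≤ 4 n` because `m = √n ≥ 1`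
  have h6 : ((m : ℝ) + 1) ^ 6 ≤ 64 * R ^ 3 * ((nx n : ℝ) ^ 2 * ns n) := by
    have k1 : ((m : ℝ) + 1) ^ 2 ≤ 4 * n := by
      have e1 : (m : ℝ) * m ≤ n := by exact_mod_cast hmn
      have e2 : (1 : ℝ) ≤ m := by exact_mod_cast hm1
      nlinarith
    calc ((m : ℝ) + 1) ^ 6 = ((((m : ℝ) + 1) ^ 2) ^ 3 : ℝ) := by ring
      _ ≤ (4 * (n : ℝ)) ^ 3 := by gcongr
      _ = 64 * ((n : ℝ) * n * n) := by ring
      _ ≤ 64 * (((R : ℝ) * nx n) * (R * nx n) * (R * ns n)) := by gcongr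
      _ = _ := by ring
  calc 1 / (nx n : ℝ) * (1 / ((nx n : ℝ) * ns n) *
        ∑ i ∈ Finset.range (nx n), ∑ j ∈ Finset.range (ns n), r (Z i ω, S j ω) ^ 2)
      ≤ 1 / (nx n : ℝ) * (1 / ((nx n : ℝ) * ns n) *
          ((64 * R ^ 3 * ((nx n : ℝ) ^ 2 * ns n)) * W m ω)) := by
        gcongr
        exact hle.trans (by gcongr)
    _ = _ := by field_simp

/-- The row means of a degenerate kernel tend to zero in empirical mean square, almost surely. With
`l = √(ns n)`, a row sum is split at column `l²`. The sums up to `l²` have variance of the order of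
their length, and the at most `2 l + 1` further terms are bounded by Cauchy-Schwarz; after
normalization, both contributions have expectations of order `1 / l²`. -/
theorem ae_tendsto_mean_sq_mean [IsProbabilityMeasure D] [IsProbabilityMeasure M]
    (h : TwoWayIID P D M Z S) {r : 𝒵 × 𝒮 → ℝ} (hr : Measurable r)
    (hr2 : MemLp r 2 (D.prod M)) (hrz : ∀ᵐ z ∂D, ∫ s, r (z, s) ∂M = 0)
    (hrs : ∀ᵐ s ∂M, ∫ z, r (z, s) ∂D = 0) {nx ns : ℕ → ℕ} (hnx : ∀ n, nx n ≤ n)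
    {R : ℕ} (hRx : ∀ᶠ n in atTop, n ≤ R * nx n) (hRs : ∀ᶠ n in atTop, n ≤ R * ns n)
    (hns : ∀ n, ns n ≤ n) :
    ∀ᵐ ω ∂P, Tendsto (fun n ↦ 1 / (nx n : ℝ) *
      ∑ i ∈ Finset.range (nx n), (1 / (ns n : ℝ) *
        ∑ j ∈ Finset.range (ns n), r (Z i ω, S j ω)) ^ 2) atTop (𝓝 0) := by
  set E := ∫ q, r q ^ 2 ∂(D.prod M) with hE
  have hE0 : 0 ≤ E := integral_nonneg fun _ ↦ sq_nonneg _
  set U : ℕ → Ω → ℝ := fun m ω ↦ 1 / ((m : ℝ) + 1) ^ 6 *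
    ((∑ i ∈ Finset.range (R * (m + 1) ^ 2), (∑ j ∈ Finset.range (m ^ 2), r (Z i ω, S j ω)) ^ 2) +
      (2 * m + 1) * ∑ i ∈ Finset.range (R * (m + 1) ^ 2),
        ∑ j ∈ Finset.Ico (m ^ 2) ((m + 1) ^ 2), r (Z i ω, S j ω) ^ 2) with hU
  have hi : ∀ i j, Integrable (fun ω ↦ r (Z i ω, S j ω) ^ 2) P := fun i j ↦
    (h.memLp_kernel hr2 i j).integrable_sq
  have hi2 : ∀ i (B : Finset ℕ), Integrable (fun ω ↦ (∑ j ∈ B, r (Z i ω, S j ω)) ^ 2) P :=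
    fun i B ↦ (memLp_finsetSum _ fun j _ ↦ h.memLp_kernel hr2 i j).integrable_sq
  have hr0 : ∫ q, r q ∂(D.prod M) = 0 := by
    rw [integral_prod _ (hr2.integrable (by norm_num)), integral_congr_ae hrz]
    simp
  have hrow : ∀ i (B : Finset ℕ), ∫ ω, (∑ j ∈ B, r (Z i ω, S j ω)) ^ 2 ∂P ≤ B.card * E := by
    intro i B
    have key := h.integral_sq_sum_sum_le hr hr2 hr0 {i} B
    have e1 : ∫ z, (∫ s, r (z, s) ∂M) ^ 2 ∂D = 0 := by
      rw [integral_congr_ae (hrz.mono fun z hz ↦ show _ = (0 : ℝ) by simp [hz])]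
      simp
    have e2 : ∫ s, (∫ z, r (z, s) ∂D) ^ 2 ∂M = 0 := by
      rw [integral_congr_ae (hrs.mono fun z hz ↦ show _ = (0 : ℝ) by simp [hz])]
      simp
    simpa [e1, e2] using key
  have hU0 : ∀ᵐ ω ∂P, Tendsto (fun m ↦ U m ω) atTop (𝓝 0) := by
    refine ae_tendsto_zero_of_integral_le (C := 5 * R * E)
      (fun m ω ↦ by positivity) (fun m ↦ ?_) (fun m ↦ ?_)
    · exact ((integrable_finsetSum _ fun i _ ↦ hi2 i _).add ((integrable_finsetSum _ fun i _ ↦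
        integrable_finsetSum _ fun j _ ↦ hi i j).const_mul _)).const_mul _
    · simp only [hU]
      rw [integral_const_mul, integral_add (integrable_finsetSum _ fun i _ ↦ hi2 i _)
        ((integrable_finsetSum _ fun i _ ↦ integrable_finsetSum _ fun j _ ↦ hi i j).const_mul _),
        integral_const_mul, integral_finsetSum _ fun i _ ↦ hi2 i _,
        integral_finsetSum _ fun i _ ↦ integrable_finsetSum _ fun j _ ↦ hi i j,
        Finset.sum_congr rfl fun i _ ↦ integral_finsetSum (Finset.Ico (m ^ 2) ((m + 1) ^ 2))
          fun j _ ↦ hi i j]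
      simp_rw [h.integral_kernel (g := fun q ↦ r q ^ 2) (hr.pow_const 2)]
      have hcard : (((m + 1) ^ 2 - m ^ 2 : ℕ) : ℝ) = 2 * m + 1 := by
        have : (m + 1) ^ 2 - m ^ 2 = 2 * m + 1 := by
          rw [Nat.sub_eq_iff_eq_add (by gcongr; omega)]; ring
        rw [this]; push_cast; ring
      simp only [Finset.sum_const, Nat.card_Ico, Finset.card_range, nsmul_eq_mul, hcard]
      have hs := Finset.sum_le_sum fun i (_ : i ∈ Finset.range (R * (m + 1) ^ 2)) ↦
        hrow i (Finset.range (m ^ 2))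
      simp only [Finset.sum_const, Finset.card_range, nsmul_eq_mul] at hs
      push_cast at hs ⊢
      calc _ ≤ 1 / ((m : ℝ) + 1) ^ 6 * (R * (m + 1) ^ 2 * (m ^ 2 * E) +
            (2 * m + 1) * (R * (m + 1) ^ 2 * ((2 * m + 1) * E))) := by gcongr
        _ = 1 / ((m : ℝ) + 1) ^ 6 * (R * (m + 1) ^ 2 * (m ^ 2 + (2 * m + 1) ^ 2) * E) := by ring
        _ ≤ 1 / ((m : ℝ) + 1) ^ 6 * (R * (m + 1) ^ 2 * (5 * (m + 1) ^ 2) * E) := by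
            gcongr
            have : (0 : ℝ) ≤ m := by positivity
            nlinarith
        _ = _ := by field_simp
  filter_upwards [hU0] with ω hω
  have hsq : Tendsto (fun n ↦ Nat.sqrt (ns n)) atTop atTop := by
    refine tendsto_atTop.2 fun b ↦ ?_
    filter_upwards [hRs, eventually_ge_atTop (R * (b * b) + 1)] with n h1 h2
    refine Nat.le_sqrt.2 (le_of_lt ?_)
    exact Nat.lt_of_mul_lt_mul_left (a := R) (by omega)
  have hlim := (hω.comp hsq).const_mul (128 * (R : ℝ))
  rw [mul_zero] at hlim
  refine squeeze_zero' (.of_forall fun n ↦ by positivity) ?_ hlim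
  filter_upwards [hRx, hRs, eventually_ge_atTop 1] with n h1 h2 h3
  simp only [Function.comp]
  set k := ns n with hk
  set m := Nat.sqrt k with hm
  have hns0 : 0 < k := Nat.pos_of_ne_zero fun h0 ↦ by rw [h0] at h2; omega
  have hnx0 : 0 < nx n := Nat.pos_of_ne_zero fun h0 ↦ by rw [h0] at h1; omega
  have hmk : m ^ 2 ≤ k := by rw [sq]; exact Nat.sqrt_le k
  have hkm : k ≤ (m + 1) ^ 2 := by rw [sq]; exact (Nat.lt_succ_sqrt k).le
  have hm1 : 1 ≤ m := Nat.le_sqrt.2 (by omega)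
  have hnxm : nx n ≤ R * (m + 1) ^ 2 := (hnx n).trans (h2.trans (by gcongr))
  -- the row sum is split at column `m²`
  have hrowle : ∀ i, (∑ j ∈ Finset.range k, r (Z i ω, S j ω)) ^ 2 ≤
      2 * ((∑ j ∈ Finset.range (m ^ 2), r (Z i ω, S j ω)) ^ 2 +
        (2 * m + 1) * ∑ j ∈ Finset.Ico (m ^ 2) ((m + 1) ^ 2), r (Z i ω, S j ω) ^ 2) := by
    intro i
    rw [← Finset.sum_range_add_sum_Ico _ hmk]
    refine add_sq_le.trans ?_
    gcongr
    refine sq_sum_le_card_mul_sum_sq.trans ?_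
    have hc : ((Finset.Ico (m ^ 2) k).card : ℝ) ≤ 2 * m + 1 := by
      have : (Finset.Ico (m ^ 2) k).card ≤ 2 * m + 1 := by
        rw [Nat.card_Ico]
        have : (m + 1) ^ 2 = m ^ 2 + 2 * m + 1 := by ring
        omega
      exact_mod_cast this
    gcongr
  have hle : ∑ i ∈ Finset.range (nx n), (∑ j ∈ Finset.range k, r (Z i ω, S j ω)) ^ 2 ≤
      2 * (((m : ℝ) + 1) ^ 6 * U m ω) := by
    simp only [hU]
    rw [← mul_assoc (((m : ℝ) + 1) ^ 6), mul_one_div_cancel (by positivity), one_mul]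
    refine (Finset.sum_le_sum fun i _ ↦ hrowle i).trans ?_
    rw [← Finset.mul_sum, Finset.sum_add_distrib, ← Finset.mul_sum]
    gcongr
  have hUn : 0 ≤ U m ω := by positivity
  have h1' : (n : ℝ) ≤ R * nx n := by exact_mod_cast h1
  have hkn : (k : ℝ) ≤ n := by exact_mod_cast hns n
  -- `(m + 1)² ≤ 4 k` because `m = √k ≥ 1`
  have h6 : ((m : ℝ) + 1) ^ 6 ≤ 64 * R * (nx n * (k : ℝ) ^ 2) := by
    have k1 : ((m : ℝ) + 1) ^ 2 ≤ 4 * k := by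
      have e1 : (m : ℝ) ^ 2 ≤ k := by exact_mod_cast hmk
      have e2 : (1 : ℝ) ≤ m := by exact_mod_cast hm1
      nlinarith
    calc ((m : ℝ) + 1) ^ 6 = ((((m : ℝ) + 1) ^ 2) ^ 3 : ℝ) := by ring
      _ ≤ (4 * (k : ℝ)) ^ 3 := by gcongr
      _ = 64 * ((k : ℝ) * (k : ℝ) ^ 2) := by ring
      _ ≤ 64 * ((R * nx n) * (k : ℝ) ^ 2) := by gcongr; exact hkn.trans h1'
      _ = _ := by ring
  simp_rw [mul_pow]
  rw [← Finset.mul_sum]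
  calc 1 / (nx n : ℝ) * ((1 / (k : ℝ)) ^ 2 *
        ∑ i ∈ Finset.range (nx n), (∑ j ∈ Finset.range k, r (Z i ω, S j ω)) ^ 2)
      ≤ 1 / (nx n : ℝ) * ((1 / (k : ℝ)) ^ 2 *
          (2 * (64 * R * (nx n * (k : ℝ) ^ 2) * U m ω))) := by
        gcongr
        exact hle.trans (by gcongr)
    _ = _ := by field_simp; ring

end TwoWayIID

theorem ae_tendsto_average {Ω 𝒵 : Type*} [MeasurableSpace Ω] [MeasurableSpace 𝒵]
    {P : Measure Ω} {D : Measure 𝒵} {Z : ℕ → Ω → 𝒵} (hZ : ∀ i, Measurable (Z i))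
    (hlaw : ∀ i, P.map (Z i) = D) (hind : iIndepFun Z P) {φ : 𝒵 → ℝ} (hφ : Measurable φ)
    (hφi : Integrable φ D) :
    ∀ᵐ ω ∂P, Tendsto (fun n : ℕ ↦ (∑ i ∈ Finset.range n, φ (Z i ω)) / n) atTop
      (𝓝 (∫ z, φ z ∂D)) := by
  have h1 : Integrable (fun ω ↦ φ (Z 0 ω)) P := by
    rw [← hlaw 0] at hφi
    exact hφi.comp_measurable (hZ 0)
  have := strong_law_ae_real (fun i ω ↦ φ (Z i ω)) h1
    (fun i j hij ↦ (hind.indepFun hij).comp hφ hφ)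
    (fun i ↦ IdentDistrib.comp ⟨(hZ i).aemeasurable, (hZ 0).aemeasurable, by rw [hlaw, hlaw]⟩ hφ)
  have h2 : ∫ ω, φ (Z 0 ω) ∂P = ∫ z, φ z ∂D := by
    rw [← hlaw 0, integral_map (hZ 0).aemeasurable hφ.aestronglyMeasurable]
  simpa only [h2] using this

/-! ### Conditional laws of functions of independent variables -/

section CondDistrib

variable {Ω 𝒱 𝒱' 𝒲 : Type*} [MeasurableSpace Ω] [MeasurableSpace 𝒱] [MeasurableSpace 𝒱']
  [MeasurableSpace 𝒲] {P : Measure Ω} [IsProbabilityMeasure P]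

/-- If `X` and `Y` are independent, the conditional law of `G (X, Y)` given `X` is obtained by
freezing `X`. -/
theorem ae_condDistrib_eq_map_of_indepFun {X : Ω → 𝒱} {Y : Ω → 𝒲} (hX : Measurable X)
    (hY : Measurable Y) (hXY : IndepFun X Y P) {G : 𝒱 × 𝒲 → ℝ} (hG : Measurable G) :
    ∀ᵐ ω ∂P, condDistrib (fun ω ↦ G (X ω, Y ω)) X P (X ω) =
      (P.map Y).map (fun y ↦ G (X ω, y)) := by
  have hXprob : IsProbabilityMeasure (P.map X) := Measure.isProbabilityMeasure_map hX.aemeasurable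
  have hYprob : IsProbabilityMeasure (P.map Y) := Measure.isProbabilityMeasure_map hY.aemeasurable
  have hGx : ∀ x, Measurable fun y ↦ G (x, y) := fun x ↦ hG.comp measurable_prodMk_left
  set κ : Kernel 𝒱 ℝ := (Kernel.id ×ₖ Kernel.const 𝒱 (P.map Y)).map G with hκ
  have hκx : ∀ x, κ x = (P.map Y).map (fun y ↦ G (x, y)) := by
    intro x
    rw [hκ, Kernel.map_apply _ hG, Kernel.prod_apply, Kernel.id_apply, Kernel.const_apply,
      Measure.dirac_prod, Measure.map_map hG measurable_prodMk_left]
    rfl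
  have hmk : IsMarkovKernel κ := Kernel.IsMarkovKernel.map _ hG
  have hT : Measurable fun ω ↦ G (X ω, Y ω) := hG.comp (hX.prodMk hY)
  have heq : P.map (fun ω ↦ (X ω, G (X ω, Y ω))) = P.map X ⊗ₘ κ := by
    have h1 : Measurable fun q : 𝒱 × 𝒲 ↦ (q.1, G q) := measurable_fst.prodMk hG
    have h2 : P.map (fun ω ↦ (X ω, G (X ω, Y ω))) =
        ((P.map X).prod (P.map Y)).map (fun q ↦ (q.1, G q)) := by
      rw [← (indepFun_iff_map_prod_eq_prod_map_map hX.aemeasurable hY.aemeasurable).1 hXY,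
        Measure.map_map h1 (hX.prodMk hY)]
      rfl
    rw [h2]
    ext s hs
    rw [Measure.map_apply h1 hs, Measure.prod_apply (h1 hs), Measure.compProd_apply hs]
    refine lintegral_congr fun x ↦ ?_
    rw [hκx, Measure.map_apply (hGx x) (measurable_prodMk_left hs)]
    rfl
  filter_upwards [ae_of_ae_map hX.aemeasurable
    (condDistrib_ae_eq_of_measure_eq_compProd X hT.aemeasurable heq)] with ω hω
  rw [hω, hκx]

theorem indepFun_prodMk_of_indepFun {X : Ω → 𝒱} {X' : Ω → 𝒱'} {Y : Ω → 𝒲} (hX : Measurable X)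
    (hX' : Measurable X') (hY : Measurable Y) (hXX' : IndepFun X X' P)
    (h : IndepFun (fun ω ↦ (X ω, X' ω)) Y P) : IndepFun X (fun ω ↦ (X' ω, Y ω)) P := by
  have h1 := (indepFun_iff_map_prod_eq_prod_map_map hX.aemeasurable hX'.aemeasurable).1 hXX'
  have h2 := (indepFun_iff_map_prod_eq_prod_map_map (hX.prodMk hX').aemeasurable
    hY.aemeasurable).1 h
  have hX'Y : IndepFun X' Y P := h.comp measurable_snd measurable_id
  have h3 := (indepFun_iff_map_prod_eq_prod_map_map hX'.aemeasurable hY.aemeasurable).1 hX'Y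
  have hXprob : IsProbabilityMeasure (P.map X) := Measure.isProbabilityMeasure_map hX.aemeasurable
  have hX'prob : IsProbabilityMeasure (P.map X') :=
    Measure.isProbabilityMeasure_map hX'.aemeasurable
  have hYprob : IsProbabilityMeasure (P.map Y) := Measure.isProbabilityMeasure_map hY.aemeasurable
  rw [indepFun_iff_map_prod_eq_prod_map_map hX.aemeasurable (hX'.prodMk hY).aemeasurable, h3,
    ← Measure.prodAssoc_prod, ← h1, ← h2,
    Measure.map_map MeasurableEquiv.prodAssoc.measurable ((hX.prodMk hX').prodMk hY)]
  rfl

theorem charFun_map_prod {μ : Measure 𝒱} [IsProbabilityMeasure μ] {ν : Measure 𝒲}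
    [IsProbabilityMeasure ν] {G : 𝒱 × 𝒲 → ℝ} (hG : Measurable G) (t : ℝ) :
    charFun ((μ.prod ν).map G) t = ∫ x, charFun (ν.map fun y ↦ G (x, y)) t ∂μ := by
  have hGx : ∀ x, Measurable fun y ↦ G (x, y) := fun x ↦ hG.comp measurable_prodMk_left
  rw [charFun_apply_real, integral_map hG.aemeasurable (by fun_prop), integral_prod]
  · refine integral_congr_ae (.of_forall fun x ↦ ?_)
    simp only
    rw [charFun_apply_real, integral_map (hGx x).aemeasurable
      (by fun_prop)]
  · refine (integrable_const (1 : ℝ)).mono' (by fun_prop) (.of_forall fun q ↦ ?_)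
    rw [← Complex.ofReal_mul, Complex.norm_exp_ofReal_mul_I]

theorem measurable_charFun_map_prodMk {ν : Measure 𝒲}
    [IsProbabilityMeasure ν] {G : 𝒱 × 𝒲 → ℝ} (hG : Measurable G) (t : ℝ) :
    Measurable fun x ↦ charFun (ν.map fun y ↦ G (x, y)) t := by
  have hGx : ∀ x, Measurable fun y ↦ G (x, y) := fun x ↦ hG.comp measurable_prodMk_left
  have h1 : ∀ x, charFun (ν.map fun y ↦ G (x, y)) t =
      ∫ y, Complex.exp (t * G (x, y) * Complex.I) ∂ν := fun x ↦ by
    rw [charFun_apply_real, integral_map (hGx x).aemeasurable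
      (by fun_prop)]
  simp_rw [h1]
  refine StronglyMeasurable.measurable (StronglyMeasurable.integral_prod_right'
    (f := fun q : 𝒱 × 𝒲 ↦ Complex.exp (t * G q * Complex.I)) ?_)
  exact Measurable.stronglyMeasurable (by fun_prop)

end CondDistrib

/-- The uniform law on `Fin m`. It is the zero measure for `m = 0`. -/
noncomputable def uniformFin (m : ℕ) : Measure (Fin m) := (m : ℝ≥0∞)⁻¹ • Measure.count

theorem isProbabilityMeasure_uniformFin {m : ℕ} (hm : 0 < m) :
    IsProbabilityMeasure (uniformFin m) := by
  refine ⟨?_⟩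
  simp only [uniformFin, Measure.smul_apply, smul_eq_mul, Measure.count_univ]
  rw [ENat.card_eq_coe_fintype_card, Fintype.card_fin]
  exact ENNReal.inv_mul_cancel (by simp; omega) (by simp)

instance isFiniteMeasure_uniformFin (m : ℕ) : IsFiniteMeasure (uniformFin m) := by
  rcases Nat.eq_zero_or_pos m with rfl | hm
  · refine ⟨?_⟩
    rw [Set.univ_eq_empty_iff.2 inferInstance, measure_empty]
    exact ENNReal.zero_lt_top
  · have := isProbabilityMeasure_uniformFin hm
    infer_instance

theorem integral_uniformFin {m : ℕ} (φ : Fin m → ℝ) :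
    ∫ i, φ i ∂(uniformFin m) = 1 / (m : ℝ) * ∑ i, φ i := by
  rw [uniformFin, integral_smul_measure, integral_count]
  simp

theorem map_eq_uniformFin {Ω : Type*} [MeasurableSpace Ω] {P : Measure Ω} {m : ℕ}
    {X : Ω → Fin m} (hX : Measurable X) (h : ∀ a, P {ω | X ω = a} = (m : ℝ≥0∞)⁻¹) :
    P.map X = uniformFin m := by
  refine Measure.ext_of_singleton fun a ↦ ?_
  rw [Measure.map_apply hX (measurableSet_singleton a)]
  simp only [uniformFin, Measure.smul_apply, Measure.count_singleton, smul_eq_mul, mul_one]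
  exact h a

theorem IsTwoWayResample.twoWayIID {Ω 𝒱 : Type*} [MeasurableSpace Ω] [MeasurableSpace 𝒱]
    {P : Measure Ω} {V : Ω → 𝒱} {m k : ℕ} {I : Ω → Fin m → Fin m} {J : Ω → Fin k → Fin k}
    (h : IsTwoWayResample P V I J) :
    TwoWayIID P (uniformFin m) (uniformFin k) (fun i ω ↦ I ω i) (fun j ω ↦ J ω j) where
  measurable_left i := (measurable_pi_apply i).comp h.measurable_left
  measurable_right j := (measurable_pi_apply j).comp h.measurable_right
  law_left i := map_eq_uniformFin ((measurable_pi_apply i).comp h.measurable_left)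
    (h.uniform_left i)
  law_right j := map_eq_uniformFin ((measurable_pi_apply j).comp h.measurable_right)
    (h.uniform_right j)
  indep_left := h.iIndep_left
  indep_right := h.iIndep_right
  indep := h.indep

/-! ### Typical data and the bootstrap for fixed data -/

theorem exists_integral_tail_lt {𝒵 : Type*} [MeasurableSpace 𝒵] {D : Measure 𝒵} {a : 𝒵 → ℝ}
    (ha : Measurable a) (ha2 : MemLp a 2 D) {ε : ℝ} (hε : 0 < ε) :
    ∃ K : ℕ, 0 < K ∧
      ∫ z, {z | (K : ℝ) < |a z|}.indicator (fun z ↦ a z ^ 2) z ∂D < ε := by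
  have hlim : Tendsto (fun K : ℕ ↦
      ∫ z, {z | (K : ℝ) < |a z|}.indicator (fun z ↦ a z ^ 2) z ∂D) atTop (𝓝 (∫ _, (0 : ℝ) ∂D)) := by
    refine tendsto_integral_of_dominated_convergence (fun z ↦ a z ^ 2) (fun K ↦ ?_)
      ha2.integrable_sq (fun K ↦ .of_forall fun z ↦ ?_) (.of_forall fun z ↦ ?_)
    · exact ((ha.pow_const 2).indicator
        (measurableSet_lt measurable_const ha.abs)).aestronglyMeasurable
    · rw [Real.norm_of_nonneg (Set.indicator_nonneg (fun _ _ ↦ sq_nonneg _) _)]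
      exact Set.indicator_le_self' (fun _ _ ↦ sq_nonneg _) _
    · refine tendsto_const_nhds.congr' ?_
      filter_upwards [eventually_ge_atTop ⌈|a z|⌉₊] with K hK
      rw [Set.indicator_of_notMem]
      simpa using Nat.ceil_le.1 hK
  rw [integral_zero] at hlim
  obtain ⟨K, h1, h2⟩ := ((hlim.eventually_lt_const hε).and (eventually_gt_atTop 0)).exists
  exact ⟨K, h2, h1⟩

/-- The sequence `z` obeys the law of large numbers, with limits given by `D`, for `a`, for `a ^ 2`
and for the tails of `a ^ 2` above each natural number. -/
structure IsTypicalSeq {𝒵 : Type*} [MeasurableSpace 𝒵] (D : Measure 𝒵) (a : 𝒵 → ℝ) (z : ℕ → 𝒵) :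
    Prop where
  mean : Tendsto (fun n : ℕ ↦ (∑ i ∈ Finset.range n, a (z i)) / n) atTop (𝓝 (∫ x, a x ∂D))
  mean_sq : Tendsto (fun n : ℕ ↦ (∑ i ∈ Finset.range n, a (z i) ^ 2) / n) atTop
    (𝓝 (∫ x, a x ^ 2 ∂D))
  mean_tail : ∀ K : ℕ, Tendsto (fun n : ℕ ↦ (∑ i ∈ Finset.range n,
      {x | (K : ℝ) < |a x|}.indicator (fun x ↦ a x ^ 2) (z i)) / n) atTop
    (𝓝 (∫ x, {x | (K : ℝ) < |a x|}.indicator (fun x ↦ a x ^ 2) x ∂D))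

section Seq

variable {𝒵 : Type*} [MeasurableSpace 𝒵] {D : Measure 𝒵} {a : 𝒵 → ℝ}

theorem measurable_indicator_sq (ha : Measurable a) (K : ℝ) :
    Measurable ({x | K < |a x|}.indicator (fun x ↦ a x ^ 2)) :=
  (ha.pow_const 2).indicator (measurableSet_lt measurable_const ha.abs)

theorem measurableSet_isTypicalSeq (ha : Measurable a) :
    MeasurableSet {z | IsTypicalSeq D a z} := by
  have hs : ∀ {φ : 𝒵 → ℝ} (_ : Measurable φ) (c : ℝ), MeasurableSet
      {z : ℕ → 𝒵 | Tendsto (fun n : ℕ ↦ (∑ i ∈ Finset.range n, φ (z i)) / n) atTop (𝓝 c)} := by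
    intro φ hφ c
    refine measurableSet_tendsto_fun (fun n ↦ ?_) measurable_const
    exact (Finset.measurable_sum _ fun i _ ↦ hφ.comp (measurable_pi_apply i)).div_const _
  have : {z | IsTypicalSeq D a z} =
      ({z : ℕ → 𝒵 | Tendsto (fun n : ℕ ↦ (∑ i ∈ Finset.range n, a (z i)) / n) atTop
        (𝓝 (∫ x, a x ∂D))} ∩
      {z : ℕ → 𝒵 | Tendsto (fun n : ℕ ↦ (∑ i ∈ Finset.range n, a (z i) ^ 2) / n) atTop
        (𝓝 (∫ x, a x ^ 2 ∂D))}) ∩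
      ⋂ K : ℕ, {z : ℕ → 𝒵 | Tendsto (fun n : ℕ ↦ (∑ i ∈ Finset.range n,
        {x | (K : ℝ) < |a x|}.indicator (fun x ↦ a x ^ 2) (z i)) / n) atTop
        (𝓝 (∫ x, {x | (K : ℝ) < |a x|}.indicator (fun x ↦ a x ^ 2) x ∂D))} := by
    ext z
    simp only [Set.mem_inter_iff, Set.mem_iInter, Set.mem_ofPred_eq]
    exact ⟨fun h ↦ ⟨⟨h.mean, h.mean_sq⟩, h.mean_tail⟩, fun h ↦ ⟨h.1.1, h.1.2, h.2⟩⟩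
  rw [this]
  exact ((hs ha _).inter (hs (φ := fun x ↦ a x ^ 2) (ha.pow_const 2) _)).inter
    (MeasurableSet.iInter fun K ↦ hs (measurable_indicator_sq ha K) _)

theorem ae_isTypicalSeq {Ω : Type*} [MeasurableSpace Ω]
    {P : Measure Ω} [IsProbabilityMeasure D] {Z : ℕ → Ω → 𝒵} (hZ : ∀ i, Measurable (Z i))
    (hlaw : ∀ i, P.map (Z i) = D) (hind : iIndepFun Z P) (ha : Measurable a)
    (ha2 : MemLp a 2 D) : ∀ᵐ ω ∂P, IsTypicalSeq D a (fun i ↦ Z i ω) := by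
  have h3 := ae_all_iff.2 fun K : ℕ ↦ ae_tendsto_average hZ hlaw hind
    (measurable_indicator_sq ha K)
    (ha2.integrable_sq.indicator (measurableSet_lt measurable_const ha.abs))
  filter_upwards [ae_tendsto_average hZ hlaw hind ha (ha2.integrable (by norm_num)),
    ae_tendsto_average hZ hlaw hind (ha.pow_const 2) ha2.integrable_sq, h3] with ω h1 h2 h3
  exact ⟨h1, h2, h3⟩

theorem integral_uniformFin_eq_average {m : ℕ} (φ : ℕ → ℝ) :
    ∫ i : Fin m, φ i ∂(uniformFin m) = (∑ i ∈ Finset.range m, φ i) / m := by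
  rw [integral_uniformFin, Finset.sum_range, one_div, inv_mul_eq_div]

theorem IsTypicalSeq.eventually_tail_le {z : ℕ → 𝒵} (h : IsTypicalSeq D a z) (ha : Measurable a)
    (ha2 : MemLp a 2 D) {m : ℕ → ℕ} (hm : Tendsto m atTop atTop) {ε : ℝ} (hε : 0 < ε) :
    ∃ K : ℝ, K > 0 ∧ ∀ᶠ n in atTop,
      ∫ i : Fin (m n), {i : Fin (m n) | K < |a (z i)|}.indicator (fun i ↦ a (z i) ^ 2) i
        ∂(uniformFin (m n)) ≤ ε := by
  obtain ⟨K, hK, hKε⟩ := exists_integral_tail_lt ha ha2 hε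
  refine ⟨K, by exact_mod_cast hK, ?_⟩
  filter_upwards [((h.mean_tail K).comp hm).eventually_lt_const hKε] with n hn
  refine le_of_eq_of_le ?_ hn.le
  exact integral_uniformFin_eq_average
    (fun i ↦ {x | (K : ℝ) < |a x|}.indicator (fun x ↦ a x ^ 2) (z i))

end Seq

/-- The data `z`, `s` behave as almost every sample from `D` and `M` does: the main effects `a`, `b`
obey the laws of large numbers of `IsTypicalSeq`, and the interaction `r` is asymptotically
negligible on the `m n × k n` arrays, in mean square and in its row and column means. This is what
the bootstrap central limit theorem for fixed data uses. -/
structure IsTypicalArray {𝒵 𝒮 : Type*} [MeasurableSpace 𝒵] [MeasurableSpace 𝒮] (D : Measure 𝒵)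
    (M : Measure 𝒮) (a : 𝒵 → ℝ) (b : 𝒮 → ℝ) (r : 𝒵 × 𝒮 → ℝ) (m k : ℕ → ℕ) (z : ℕ → 𝒵)
    (s : ℕ → 𝒮) : Prop where
  left : IsTypicalSeq D a z
  right : IsTypicalSeq M b s
  mean_sq : Tendsto (fun n ↦ 1 / (m n : ℝ) * (1 / ((m n : ℝ) * k n) *
      ∑ i ∈ Finset.range (m n), ∑ j ∈ Finset.range (k n), r (z i, s j) ^ 2)) atTop (𝓝 0)
  row_mean : Tendsto (fun n ↦ 1 / (m n : ℝ) * ∑ i ∈ Finset.range (m n),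
      (1 / (k n : ℝ) * ∑ j ∈ Finset.range (k n), r (z i, s j)) ^ 2) atTop (𝓝 0)
  column_mean : Tendsto (fun n ↦ 1 / (k n : ℝ) * ∑ j ∈ Finset.range (k n),
      (1 / (m n : ℝ) * ∑ i ∈ Finset.range (m n), r (z i, s j)) ^ 2) atTop (𝓝 0)

section Array

variable {𝒵 𝒮 : Type*} [MeasurableSpace 𝒵] [MeasurableSpace 𝒮] {D : Measure 𝒵}
  {M : Measure 𝒮} {a : 𝒵 → ℝ} {b : 𝒮 → ℝ} {r : 𝒵 × 𝒮 → ℝ} {m k : ℕ → ℕ}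

theorem measurableSet_isTypicalArray (ha : Measurable a) (hb : Measurable b) (hr : Measurable r) :
    MeasurableSet {v : (ℕ → 𝒵) × (ℕ → 𝒮) | IsTypicalArray D M a b r m k v.1 v.2} := by
  have hrij : ∀ i j : ℕ, Measurable fun v : (ℕ → 𝒵) × (ℕ → 𝒮) ↦ r (v.1 i, v.2 j) := fun i j ↦
    hr.comp (by fun_prop)
  have h1 := (measurableSet_isTypicalSeq (D := D) ha).preimage
    (measurable_fst : Measurable (Prod.fst : (ℕ → 𝒵) × (ℕ → 𝒮) → _))
  have h2 := (measurableSet_isTypicalSeq (D := M) hb).preimage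
    (measurable_snd : Measurable (Prod.snd : (ℕ → 𝒵) × (ℕ → 𝒮) → _))
  have h3 : MeasurableSet {v : (ℕ → 𝒵) × (ℕ → 𝒮) | Tendsto (fun n ↦ 1 / (m n : ℝ) *
      (1 / ((m n : ℝ) * k n) * ∑ i ∈ Finset.range (m n), ∑ j ∈ Finset.range (k n),
        r (v.1 i, v.2 j) ^ 2)) atTop (𝓝 0)} :=
    measurableSet_tendsto_fun (fun n ↦ by fun_prop) measurable_const
  have h4 : MeasurableSet {v : (ℕ → 𝒵) × (ℕ → 𝒮) | Tendsto (fun n ↦ 1 / (m n : ℝ) *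
      ∑ i ∈ Finset.range (m n),
        (1 / (k n : ℝ) * ∑ j ∈ Finset.range (k n), r (v.1 i, v.2 j)) ^ 2) atTop (𝓝 0)} :=
    measurableSet_tendsto_fun (fun n ↦ by fun_prop) measurable_const
  have h5 : MeasurableSet {v : (ℕ → 𝒵) × (ℕ → 𝒮) | Tendsto (fun n ↦ 1 / (k n : ℝ) *
      ∑ j ∈ Finset.range (k n),
        (1 / (m n : ℝ) * ∑ i ∈ Finset.range (m n), r (v.1 i, v.2 j)) ^ 2) atTop (𝓝 0)} :=
    measurableSet_tendsto_fun (fun n ↦ by fun_prop) measurable_const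
  convert! (h1.inter h2).inter ((h3.inter h4).inter h5) using 1
  ext v
  simp only [Set.mem_inter_iff, Set.mem_preimage, Set.mem_ofPred_eq]
  exact ⟨fun h ↦ ⟨⟨h.left, h.right⟩, ⟨h.mean_sq, h.row_mean⟩, h.column_mean⟩,
    fun h ↦ ⟨h.1.1, h.1.2, h.2.1.1, h.2.1.2, h.2.2⟩⟩

theorem TwoWayIID.ae_isTypicalArray {Ω : Type*} [MeasurableSpace Ω] {P : Measure Ω}
    [IsProbabilityMeasure P] [IsProbabilityMeasure D] [IsProbabilityMeasure M]
    {Z : ℕ → Ω → 𝒵} {S : ℕ → Ω → 𝒮} (h : TwoWayIID P D M Z S)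
    (ha : Measurable a) (hb : Measurable b) (hr : Measurable r) (ha2 : MemLp a 2 D)
    (hb2 : MemLp b 2 M) (hr2 : MemLp r 2 (D.prod M)) (hrz : ∀ᵐ z ∂D, ∫ s, r (z, s) ∂M = 0)
    (hrs : ∀ᵐ s ∂M, ∫ z, r (z, s) ∂D = 0) (hm : ∀ n, m n ≤ n) (hk : ∀ n, k n ≤ n)
    {R : ℕ} (hRm : ∀ᶠ n in atTop, n ≤ R * m n) (hRk : ∀ᶠ n in atTop, n ≤ R * k n) :
    ∀ᵐ ω ∂P, IsTypicalArray D M a b r m k (fun i ↦ Z i ω) (fun j ↦ S j ω) := by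
  filter_upwards [ae_isTypicalSeq h.measurable_left h.law_left h.indep_left ha ha2,
    ae_isTypicalSeq h.measurable_right h.law_right h.indep_right hb hb2,
    h.ae_tendsto_mean_sq_div hr hr2 hm hk hRm hRk,
    h.ae_tendsto_mean_sq_mean hr hr2 hrz hrs hm hRm hRk hk,
    h.swap.ae_tendsto_mean_sq_mean (hr.comp measurable_swap)
      (hr2.comp_measurePreserving Measure.measurePreserving_swap) hrs hrz hk hRk hRm hm]
    with ω h1 h2 h3 h4 h5
  exact ⟨h1, h2, h3, h4, h5⟩

/-- The bootstrap central limit theorem for fixed typical data; only the indices are random. -/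
theorem IsTypicalArray.tendsto_charFun {Ω : Type*} [MeasurableSpace Ω] {P : Measure Ω}
    [IsProbabilityMeasure P] {z : ℕ → 𝒵} {s : ℕ → 𝒮} (h : IsTypicalArray D M a b r m k z s)
    (ha : Measurable a) (hb : Measurable b) (ha2 : MemLp a 2 D) (hb2 : MemLp b 2 M)
    (ha0 : ∫ z, a z ∂D = 0) (hb0 : ∫ s, b s ∂M = 0)
    (hm : Tendsto m atTop atTop) (hk : Tendsto k atTop atTop)
    {I : (n : ℕ) → Ω → Fin (m n) → Fin (m n)} {J : (n : ℕ) → Ω → Fin (k n) → Fin (k n)}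
    (hIJ : ∀ n, TwoWayIID P (uniformFin (m n)) (uniformFin (k n)) (fun i ω ↦ I n ω i)
      (fun j ω ↦ J n ω j))
    {c : ℕ → ℝ} {τa τb : ℝ} (hca : Tendsto (fun n ↦ c n ^ 2 / m n) atTop (𝓝 τa))
    (hcb : Tendsto (fun n ↦ c n ^ 2 / k n) atTop (𝓝 τb)) {g : 𝒵 × 𝒮 → ℝ} {θ : ℝ}
    (hg : ∀ q, g q = θ + a q.1 + b q.2 + r q) (t : ℝ) :
    Tendsto (fun n ↦ charFun (P.map fun ω ↦ c n *
        ((1 / (k n : ℝ)) * ∑ j, (1 / (m n : ℝ)) * ∑ i, g (z (I n ω i), s (J n ω j)) -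
          (1 / (k n : ℝ)) * ∑ j : Fin (k n), (1 / (m n : ℝ)) * ∑ i : Fin (m n), g (z i, s j))) t)
      atTop (𝓝 (Real.exp (-((τa * (∫ z, a z ^ 2 ∂D) + τb * (∫ s, b s ^ 2 ∂M)) * t ^ 2 / 2)) : ℝ)) := by
  have hfin : ∀ n (φ : Fin (m n) × Fin (k n) → ℝ),
      ∫ q, φ q ∂((uniformFin (m n)).prod (uniformFin (k n))) =
      1 / (m n : ℝ) * ∑ i, (1 / (k n : ℝ) * ∑ j, φ (i, j)) := by
    intro n φ
    rw [integral_prod _ .of_finite, integral_uniformFin]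
    simp_rw [integral_uniformFin]
  have key := tendsto_charFun_of_twoWayIID (P := P)
    (D := fun n ↦ uniformFin (m n)) (M := fun n ↦ uniformFin (k n))
    (hm.eventually_gt_atTop 0 |>.mono fun n hn ↦ isProbabilityMeasure_uniformFin hn)
    (hk.eventually_gt_atTop 0 |>.mono fun n hn ↦ isProbabilityMeasure_uniformFin hn)
    hm hk hIJ (a := fun n i ↦ a (z i)) (b := fun n j ↦ b (s j))
    (r := fun n q ↦ r (z q.1, s q.2))
    (fun n ↦ measurable_of_finite _) (fun n ↦ measurable_of_finite _)
    (fun n ↦ measurable_of_finite _) (fun n ↦ .of_discrete) (fun n ↦ .of_discrete)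
    (fun n ↦ .of_discrete)
    (ha0 ▸ (h.left.mean.comp hm).congr fun n ↦
      (integral_uniformFin_eq_average (fun i ↦ a (z i))).symm)
    ((h.left.mean_sq.comp hm).congr fun n ↦
      (integral_uniformFin_eq_average (fun i ↦ a (z i) ^ 2)).symm)
    (fun ε hε ↦ h.left.eventually_tail_le ha ha2 hm hε)
    (hb0 ▸ (h.right.mean.comp hk).congr fun n ↦
      (integral_uniformFin_eq_average (fun i ↦ b (s i))).symm)
    ((h.right.mean_sq.comp hk).congr fun n ↦
      (integral_uniformFin_eq_average (fun i ↦ b (s i) ^ 2)).symm)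
    (fun ε hε ↦ h.right.eventually_tail_le hb hb2 hk hε)
    hca hcb (h.mean_sq.congr fun n ↦ ?_) (h.row_mean.congr fun n ↦ ?_)
    (h.column_mean.congr fun n ↦ ?_) t
  · refine key.congr' ?_
    filter_upwards [hm.eventually_gt_atTop 0, hk.eventually_gt_atTop 0] with n h1 h2
    congr 2
    funext ω
    have hm0 : (m n : ℝ) ≠ 0 := by positivity
    have hk0 : (k n : ℝ) ≠ 0 := by positivity
    rw [hfin, integral_uniformFin, integral_uniformFin]
    simp only [hg, ← Finset.mul_sum, Finset.sum_add_distrib, Finset.sum_const, Finset.card_univ,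
      Fintype.card_fin, nsmul_eq_mul]
    rw [Finset.sum_comm (f := fun (i : Fin (m n)) (j : Fin (k n)) ↦ r (z i, s j))]
    field_simp
    ring
  · rw [hfin]
    simp only [Finset.sum_range, ← Finset.mul_sum]
    ring
  · simp only [integral_uniformFin, Finset.sum_range]
  · simp only [integral_uniformFin, Finset.sum_range]

end Array

/-! ### Main effects, interactions and sample sizes -/

section Hoeffding

variable {𝒵 𝒮 : Type*} [MeasurableSpace 𝒵] [MeasurableSpace 𝒮]

/-- The centred conditional mean of the kernel `g` given its first argument. The main effect of the
second argument is that of the kernel with swapped arguments. -/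
noncomputable def mainEffect (D : Measure 𝒵) (M : Measure 𝒮) (g : 𝒵 × 𝒮 → ℝ) (z : 𝒵) : ℝ :=
  (∫ s, g (z, s) ∂M) - ∫ q, g q ∂(D.prod M)

/-- The part of the kernel `g` left over by its mean and its two main effects. -/
noncomputable def interaction (D : Measure 𝒵) (M : Measure 𝒮) (g : 𝒵 × 𝒮 → ℝ) (q : 𝒵 × 𝒮) : ℝ :=
  g q - (∫ q', g q' ∂(D.prod M)) - mainEffect D M g q.1 -
    mainEffect M D (fun q' ↦ g q'.swap) q.2

variable {D : Measure 𝒵} {M : Measure 𝒮} {g : 𝒵 × 𝒮 → ℝ}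

theorem measurable_mainEffect [SFinite M] (hg : Measurable g) : Measurable (mainEffect D M g) :=
  hg.stronglyMeasurable.integral_prod_right'.measurable.sub_const _

theorem eq_add_interaction (q : 𝒵 × 𝒮) :
    g q = (∫ q', g q' ∂(D.prod M)) + mainEffect D M g q.1 +
      mainEffect M D (fun q' ↦ g q'.swap) q.2 + interaction D M g q := by
  simp only [interaction]
  ring

variable [IsProbabilityMeasure D] [IsProbabilityMeasure M]

theorem memLp_mainEffect (hg : Measurable g) (hg2 : MemLp g 2 (D.prod M)) :
    MemLp (mainEffect D M g) 2 D :=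
  (memLp_integral_prod_right hg hg2).sub (memLp_const _)

theorem integral_mainEffect (hg2 : MemLp g 2 (D.prod M)) : ∫ z, mainEffect D M g z ∂D = 0 := by
  have hi : Integrable g (D.prod M) := hg2.integrable (by norm_num)
  simp only [mainEffect]
  rw [integral_sub hi.integral_prod_left (integrable_const _), integral_prod _ hi]
  simp

theorem memLp_swap (hg2 : MemLp g 2 (D.prod M)) : MemLp (fun q ↦ g q.swap) 2 (M.prod D) :=
  hg2.comp_measurePreserving Measure.measurePreserving_swap

theorem measurable_interaction (hg : Measurable g) : Measurable (interaction D M g) :=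
  ((hg.sub_const _).sub ((measurable_mainEffect hg).comp measurable_fst)).sub
    ((measurable_mainEffect (hg.comp measurable_swap)).comp measurable_snd)

theorem memLp_interaction (hg : Measurable g) (hg2 : MemLp g 2 (D.prod M)) :
    MemLp (interaction D M g) 2 (D.prod M) :=
  ((hg2.sub (memLp_const _)).sub ((memLp_mainEffect hg hg2).comp_fst M)).sub
    ((memLp_mainEffect (hg.comp measurable_swap) (memLp_swap hg2)).comp_snd D)

theorem ae_integral_interaction_right (hg : Measurable g) (hg2 : MemLp g 2 (D.prod M)) :
    ∀ᵐ z ∂D, ∫ s, interaction D M g (z, s) ∂M = 0 := by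
  have hi : Integrable g (D.prod M) := hg2.integrable (by norm_num)
  filter_upwards [hi.prod_right_ae] with z hz
  have hb : Integrable (mainEffect M D fun q ↦ g q.swap) M :=
    (memLp_mainEffect (hg.comp measurable_swap) (memLp_swap hg2)).integrable (by norm_num)
  simp only [interaction]
  have h0 : Integrable (fun s ↦ g (z, s) - ∫ q, g q ∂(D.prod M)) M :=
    hz.sub (integrable_const _)
  have h1 : Integrable (fun s ↦ g (z, s) - ∫ q, g q ∂(D.prod M) - mainEffect D M g z) M :=
    h0.sub (integrable_const _)
  rw [integral_sub h1 hb, integral_sub h0 (integrable_const _),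
    integral_sub hz (integrable_const _), integral_mainEffect (memLp_swap hg2)]
  simp [mainEffect]

theorem interaction_swap (q : 𝒵 × 𝒮) :
    interaction M D (fun q ↦ g q.swap) q.swap = interaction D M g q := by
  simp only [interaction, Prod.swap_swap, Prod.fst_swap, Prod.snd_swap]
  rw [integral_prod_swap (f := g)]
  ring

theorem ae_integral_interaction_left (hg : Measurable g) (hg2 : MemLp g 2 (D.prod M)) :
    ∀ᵐ s ∂M, ∫ z, interaction D M g (z, s) ∂D = 0 := by
  filter_upwards [ae_integral_interaction_right (hg.comp measurable_swap) (memLp_swap hg2)]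
    with s hs
  rw [← hs]
  exact integral_congr_ae (.of_forall fun z ↦ (interaction_swap (z, s)).symm)

theorem integral_interaction (hg : Measurable g) (hg2 : MemLp g 2 (D.prod M)) :
    ∫ q, interaction D M g q ∂(D.prod M) = 0 := by
  rw [integral_prod _ ((memLp_interaction hg hg2).integrable (by norm_num)),
    integral_congr_ae (ae_integral_interaction_right hg hg2)]
  simp

theorem ae_const_of_integral_mainEffect_sq_eq_zero (hg : Measurable g)
    (hg2 : MemLp g 2 (D.prod M)) (h : ∫ z, mainEffect D M g z ^ 2 ∂D = 0) :
    ∀ᵐ z ∂D, ∫ s, g (z, s) ∂M = ∫ q, g q ∂(D.prod M) := by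
  rw [integral_eq_zero_iff_of_nonneg (fun _ ↦ sq_nonneg _)
    (memLp_mainEffect hg hg2).integrable_sq] at h
  filter_upwards [h] with z hz
  have : mainEffect D M g z = 0 := by simpa using hz
  simp only [mainEffect] at this
  linarith

end Hoeffding

section SampleSize

variable {p : ℝ} {nx ns : ℕ → ℕ}

theorem tendsto_seed_fraction (hns : ∀ n, |(ns n : ℝ) - p * n| < 1) :
    Tendsto (fun n ↦ (ns n : ℝ) / n) atTop (𝓝 p) := by
  rw [tendsto_iff_norm_sub_tendsto_zero]
  refine squeeze_zero' (.of_forall fun n ↦ norm_nonneg _) ?_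
    (tendsto_one_div_atTop_nhds_zero_nat (𝕜 := ℝ))
  filter_upwards [eventually_gt_atTop 0] with n hn
  have hn' : (0 : ℝ) < n := by exact_mod_cast hn
  rw [show (ns n : ℝ) / n - p = (ns n - p * n) / n by field_simp, norm_div, Real.norm_eq_abs,
    Real.norm_of_nonneg hn'.le]
  gcongr
  exact (hns n).le

theorem tendsto_example_fraction (hn : ∀ n, nx n + ns n = n)
    (hns : ∀ n, |(ns n : ℝ) - p * n| < 1) :
    Tendsto (fun n ↦ (nx n : ℝ) / n) atTop (𝓝 (1 - p)) := by
  refine ((tendsto_seed_fraction hns).const_sub 1).congr' ?_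
  filter_upwards [eventually_gt_atTop 0] with n h
  have hn' : (n : ℝ) ≠ 0 := by positivity
  have : (nx n : ℝ) + ns n = n := by exact_mod_cast hn n
  field_simp
  linarith

theorem tendsto_sq_sqrt_div {m : ℕ → ℕ} {c : ℝ} (hc : 0 < c)
    (hm : Tendsto (fun n ↦ (m n : ℝ) / n) atTop (𝓝 c)) :
    Tendsto (fun n : ℕ ↦ √(n : ℝ) ^ 2 / m n) atTop (𝓝 c⁻¹) := by
  refine (hm.inv₀ hc.ne').congr fun n ↦ ?_
  rw [Real.sq_sqrt (by positivity), inv_div]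

/-- A positive limiting fraction `c` makes `n` at most a fixed multiple of `m n`, for every large
enough factor; this allows one factor to serve for both sample sizes. -/
theorem exists_eventually_le_mul {m : ℕ → ℕ} {c : ℝ} (hc : 0 < c)
    (hm : Tendsto (fun n ↦ (m n : ℝ) / n) atTop (𝓝 c)) :
    ∃ R : ℕ, ∀ R' ≥ R, ∀ᶠ n in atTop, n ≤ R' * m n := by
  refine ⟨⌈2 / c⌉₊, fun R' hR' ↦ ?_⟩
  filter_upwards [hm.eventually_const_lt (show c / 2 < c by linarith), eventually_gt_atTop 0]
    with n h1 h2
  have hn' : (0 : ℝ) < n := by exact_mod_cast h2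
  rw [lt_div_iff₀ hn'] at h1
  have hR : 2 / c ≤ R' := (Nat.le_ceil _).trans (by exact_mod_cast hR')
  have : (n : ℝ) ≤ R' * m n := by
    calc (n : ℝ) = 2 / c * (c / 2 * n) := by field_simp
      _ ≤ R' * m n := by gcongr
  exact_mod_cast this

theorem tendsto_atTop_of_eventually_le_mul {m : ℕ → ℕ} {R : ℕ}
    (h : ∀ᶠ n in atTop, n ≤ R * m n) : Tendsto m atTop atTop := by
  refine tendsto_atTop.2 fun b ↦ ?_
  filter_upwards [h, eventually_ge_atTop (R * b + 1)] with n h1 h2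
  exact (Nat.lt_of_mul_lt_mul_left (a := R) (by omega)).le

end SampleSize

theorem charFun_gaussianReal_zero_eq {σ2 : ℝ≥0} {v : ℝ} (h : (σ2 : ℝ) = v) (t : ℝ) :
    charFun (gaussianReal 0 σ2) t = (Real.exp (-(v * t ^ 2 / 2)) : ℝ) := by
  rw [charFun_gaussianReal, ← h]
  push_cast
  congr 1
  ring

/-- The average of `g` over the grid of all pairs of an example `z i` and a seed `s j`, with value `0`
on an empty grid. -/
noncomputable def gridMean {𝒵 𝒮 : Type*} (g : 𝒵 × 𝒮 → ℝ) {m k : ℕ} (z : Fin m → 𝒵)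
    (s : Fin k → 𝒮) : ℝ :=
  (1 / (k : ℝ)) * ∑ j, (1 / (m : ℝ)) * ∑ i, g (z i, s j)

section Main

variable {Ω 𝒵 𝒮 : Type*} [MeasurableSpace Ω] [MeasurableSpace 𝒵] [MeasurableSpace 𝒮]
  {P : Measure Ω} [IsProbabilityMeasure P] {D : Measure 𝒵} [IsProbabilityMeasure D]
  {M : Measure 𝒮} [IsProbabilityMeasure M] {g : 𝒵 × 𝒮 → ℝ}

theorem measurable_gridMean (hg : Measurable g) {α : Type*} [MeasurableSpace α] {m k : ℕ}
    {z : α → Fin m → 𝒵} {s : α → Fin k → 𝒮} (hz : ∀ i, Measurable fun x ↦ z x i)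
    (hs : ∀ j, Measurable fun x ↦ s x j) : Measurable fun x ↦ gridMean g (z x) (s x) := by
  have : ∀ i j, Measurable fun x ↦ g (z x i, s x j) := fun i j ↦
    hg.comp ((hz i).prodMk (hs j))
  simp only [gridMean]
  fun_prop

/-- The scaled difference of the bootstrap average and the sample average, as a function of the data
`q.1` and of the resampled indices `q.2`. -/
noncomputable def bootstrapError (g : 𝒵 × 𝒮 → ℝ) (c : ℝ) {m k : ℕ}
    (q : ((ℕ → 𝒵) × (ℕ → 𝒮)) × ((Fin m → Fin m) × (Fin k → Fin k))) : ℝ :=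
  c * (gridMean g (fun i ↦ q.1.1 (q.2.1 i)) (fun j ↦ q.1.2 (q.2.2 j)) -
    gridMean g (fun i : Fin m ↦ q.1.1 i) (fun j : Fin k ↦ q.1.2 j))

theorem measurable_bootstrapError (hg : Measurable g) (c : ℝ) {m k : ℕ} :
    Measurable (bootstrapError g c (m := m) (k := k)) := by
  refine measurable_from_prod_countable_left fun u ↦ ?_
  exact ((measurable_gridMean hg
    (fun i ↦ (measurable_pi_apply (u.1 i : ℕ)).comp measurable_fst)
    fun j ↦ (measurable_pi_apply (u.2 j : ℕ)).comp measurable_snd).sub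
    (measurable_gridMean hg (fun i ↦ (measurable_pi_apply (i : ℕ)).comp measurable_fst)
      fun j ↦ (measurable_pi_apply (j : ℕ)).comp measurable_snd)).const_mul c

theorem TwoWayIID.tendsto_charFun_gridMean {Z : ℕ → Ω → 𝒵} {S : ℕ → Ω → 𝒮}
    (h : TwoWayIID P D M Z S) (hg : Measurable g) (hg2 : MemLp g 2 (D.prod M)) {m k : ℕ → ℕ}
    (hm : Tendsto m atTop atTop) (hk : Tendsto k atTop atTop)
    {c : ℕ → ℝ} {τa τb : ℝ} (hca : Tendsto (fun n ↦ c n ^ 2 / m n) atTop (𝓝 τa))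
    (hcb : Tendsto (fun n ↦ c n ^ 2 / k n) atTop (𝓝 τb)) (t : ℝ) :
    Tendsto (fun n ↦ charFun (P.map fun ω ↦ c n *
        (gridMean g (fun i : Fin (m n) ↦ Z i ω) (fun j : Fin (k n) ↦ S j ω) -
          ∫ q, g q ∂(D.prod M))) t) atTop
      (𝓝 (Real.exp (-((τa * (∫ z, mainEffect D M g z ^ 2 ∂D) +
        τb * (∫ s, mainEffect M D (fun q ↦ g q.swap) s ^ 2 ∂M)) * t ^ 2 / 2)) : ℝ)) := by
  have hgs : Measurable fun q : 𝒮 × 𝒵 ↦ g q.swap := hg.comp measurable_swap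
  have ha := measurable_mainEffect (D := D) (M := M) hg
  have hb := measurable_mainEffect (D := M) (M := D) hgs
  have ha2 := memLp_mainEffect hg hg2
  have hb2 := memLp_mainEffect hgs (memLp_swap hg2)
  have ha0 := integral_mainEffect hg2
  have hb0 := integral_mainEffect (memLp_swap hg2)
  have hr1 : ∫ z, (∫ s, interaction D M g (z, s) ∂M) ^ 2 ∂D = 0 := by
    rw [integral_congr_ae ((ae_integral_interaction_right hg hg2).mono fun z hz ↦
      show _ = (0 : ℝ) by simp [hz])]
    simp
  have hr2 : ∫ s, (∫ z, interaction D M g (z, s) ∂D) ^ 2 ∂M = 0 := by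
    rw [integral_congr_ae ((ae_integral_interaction_left hg hg2).mono fun z hz ↦
      show _ = (0 : ℝ) by simp [hz])]
    simp
  have key := tendsto_charFun_of_twoWayIID (P := P) (D := fun _ ↦ D) (M := fun _ ↦ M)
    (.of_forall fun _ ↦ inferInstance) (.of_forall fun _ ↦ inferInstance) hm hk
    (fun n ↦ h.reindex (e := fun i : Fin (m n) ↦ (i : ℕ)) (e' := fun j : Fin (k n) ↦ (j : ℕ))
      Fin.val_injective Fin.val_injective)
    (a := fun _ ↦ mainEffect D M g) (b := fun _ ↦ mainEffect M D fun q ↦ g q.swap)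
    (r := fun _ ↦ interaction D M g) (fun _ ↦ ha) (fun _ ↦ hb)
    (fun _ ↦ measurable_interaction hg) (fun _ ↦ ha2) (fun _ ↦ hb2)
    (fun _ ↦ memLp_interaction hg hg2)
    (by simp only [ha0]; exact tendsto_const_nhds) tendsto_const_nhds
    (fun ε hε ↦ by
      obtain ⟨K, hK, hKε⟩ := exists_integral_tail_lt ha ha2 hε
      exact ⟨K, by exact_mod_cast hK, .of_forall fun _ ↦ hKε.le⟩)
    (by simp only [hb0]; exact tendsto_const_nhds) tendsto_const_nhds
    (fun ε hε ↦ by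
      obtain ⟨K, hK, hKε⟩ := exists_integral_tail_lt hb hb2 hε
      exact ⟨K, by exact_mod_cast hK, .of_forall fun _ ↦ hKε.le⟩)
    hca hcb
    (by
      have := (tendsto_one_div_atTop_nhds_zero_nat (𝕜 := ℝ)).comp hm
      simpa [Function.comp_def] using this.mul_const
        (∫ q, interaction D M g q ^ 2 ∂(D.prod M)))
    (by simp only [hr1]; exact tendsto_const_nhds) (by simp only [hr2]; exact tendsto_const_nhds) t
  refine key.congr' ?_
  filter_upwards [hm.eventually_gt_atTop 0, hk.eventually_gt_atTop 0] with n h1 h2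
  congr 2
  funext ω
  have hm0 : (m n : ℝ) ≠ 0 := by positivity
  have hk0 : (k n : ℝ) ≠ 0 := by positivity
  have hdec : ∀ q, g q = _ := eq_add_interaction (D := D) (M := M) (g := g)
  rw [ha0, hb0, integral_interaction hg hg2]
  simp only [gridMean]
  simp only [fun i j ↦ hdec (Z i ω, S j ω), ← Finset.mul_sum, Finset.sum_add_distrib,
    Finset.sum_const, Finset.card_univ,
    Fintype.card_fin, nsmul_eq_mul]
  field_simp
  ring

end Main

/-! ### Convergence of the conditional laws -/

section Main

variable {Ω 𝒵 𝒮 : Type*} [MeasurableSpace Ω] [MeasurableSpace 𝒵] [MeasurableSpace 𝒮]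
  {P : Measure Ω} [IsProbabilityMeasure P] {g : 𝒵 × 𝒮 → ℝ}
  {m k : ℕ → ℕ} {I : (n : ℕ) → Ω → Fin (m n) → Fin (m n)}
  {J : (n : ℕ) → Ω → Fin (k n) → Fin (k n)} {c : ℕ → ℝ} {Z : ℕ → Ω → 𝒵} {S : ℕ → Ω → 𝒮}
  {σ2 : ℝ≥0}

theorem condTendstoInDistribution_of_forall_charFun {𝒱 : Type*} [MeasurableSpace 𝒱]
    {T : ℕ → Ω → ℝ} {V : Ω → 𝒱} {ν : Measure ℝ} [IsProbabilityMeasure ν]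
    (h : ∀ᵐ ω ∂P, ∀ t, Tendsto (fun n ↦ charFun (condDistrib (T n) V P (V ω)) t) atTop
      (𝓝 (charFun ν t))) : CondTendstoInDistribution T V P ν := by
  filter_upwards [h] with ω hω
  exact ProbabilityMeasure.tendsto_of_tendsto_charFun hω

theorem condTendstoInDistribution_of_indepFun {𝒱 : Type*} [MeasurableSpace 𝒱] {𝒲 : ℕ → Type*}
    [∀ n, MeasurableSpace (𝒲 n)] {X : Ω → 𝒱} {U : (n : ℕ) → Ω → 𝒲 n} (hX : Measurable X)
    (hU : ∀ n, Measurable (U n)) (hXU : ∀ n, IndepFun X (U n) P) {G : (n : ℕ) → 𝒱 × 𝒲 n → ℝ}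
    (hG : ∀ n, Measurable (G n)) {ν : Measure ℝ} [IsProbabilityMeasure ν]
    (h : ∀ᵐ ω ∂P, ∀ t, Tendsto (fun n ↦ charFun ((P.map (U n)).map fun u ↦ G n (X ω, u)) t) atTop
      (𝓝 (charFun ν t))) :
    CondTendstoInDistribution (fun n ω ↦ G n (X ω, U n ω)) X P ν := by
  have hc := ae_all_iff.2 fun n ↦ ae_condDistrib_eq_map_of_indepFun hX (hU n) (hXU n) (hG n)
  refine condTendstoInDistribution_of_forall_charFun ?_
  filter_upwards [hc, h] with ω h1 h2 t
  simpa only [h1] using h2 t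

/-- Convergence of the laws obtained by freezing both `X` and `X'` implies convergence of the
conditional laws given `X` alone, which are averages over the law of `X'`. -/
theorem condTendstoInDistribution_fst_of_indepFun {𝒱 𝒱' : Type*} [MeasurableSpace 𝒱]
    [MeasurableSpace 𝒱'] {𝒲 : ℕ → Type*} [∀ n, MeasurableSpace (𝒲 n)] {X : Ω → 𝒱} {X' : Ω → 𝒱'}
    {U : (n : ℕ) → Ω → 𝒲 n} (hX : Measurable X) (hX' : Measurable X')
    (hU : ∀ n, Measurable (U n)) (hXX' : IndepFun X X' P)
    (hXU : ∀ n, IndepFun (fun ω ↦ (X ω, X' ω)) (U n) P)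
    {G : (n : ℕ) → (𝒱 × 𝒱') × 𝒲 n → ℝ} (hG : ∀ n, Measurable (G n)) {ν : Measure ℝ}
    [IsProbabilityMeasure ν]
    (h : ∀ᵐ x ∂(P.map X), ∀ᵐ x' ∂(P.map X'), ∀ t, Tendsto
      (fun n ↦ charFun ((P.map (U n)).map fun u ↦ G n ((x, x'), u)) t) atTop
      (𝓝 (charFun ν t))) :
    CondTendstoInDistribution (fun n ω ↦ G n ((X ω, X' ω), U n ω)) X P ν := by
  have hX'prob : IsProbabilityMeasure (P.map X') := Measure.isProbabilityMeasure_map hX'.aemeasurable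
  have hUprob : ∀ n, IsProbabilityMeasure (P.map (U n)) := fun n ↦
    Measure.isProbabilityMeasure_map (hU n).aemeasurable
  have hG' : ∀ n, Measurable fun q : 𝒱 × (𝒱' × 𝒲 n) ↦ G n ((q.1, q.2.1), q.2.2) := fun n ↦
    (hG n).comp (by fun_prop)
  refine condTendstoInDistribution_of_indepFun (U := fun n ω ↦ (X' ω, U n ω)) hX
    (fun n ↦ hX'.prodMk (hU n))
    (fun n ↦ indepFun_prodMk_of_indepFun hX hX' (hU n) hXX' (hXU n)) hG' ?_
  filter_upwards [ae_of_ae_map hX.aemeasurable h] with ω h2 t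
  have hGω : ∀ n, Measurable fun q : 𝒱' × 𝒲 n ↦ G n ((X ω, q.1), q.2) := fun n ↦
    (hG' n).comp measurable_prodMk_left
  have hprod : ∀ n, P.map (fun ω ↦ (X' ω, U n ω)) = (P.map X').prod (P.map (U n)) := fun n ↦
    (indepFun_iff_map_prod_eq_prod_map_map hX'.aemeasurable (hU n).aemeasurable).1
      ((hXU n).comp measurable_snd measurable_id)
  have hconst : ∫ _, charFun ν t ∂(P.map X') = charFun ν t := by simp
  rw [← hconst]
  simp only [hprod, charFun_map_prod (hGω _)]
  refine tendsto_integral_of_dominated_convergence (fun _ ↦ 1) (fun n ↦ ?_) (integrable_const _)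
    (fun n ↦ .of_forall fun s ↦ ?_) (h2.mono fun s hs ↦ hs t)
  · exact (measurable_charFun_map_prodMk (hGω n) t).aestronglyMeasurable
  · have : IsProbabilityMeasure ((P.map (U n)).map fun u ↦ G n ((X ω, s), u)) :=
      Measure.isProbabilityMeasure_map ((hGω n).comp measurable_prodMk_left).aemeasurable
    exact norm_charFun_le_one t

theorem IsTypicalArray.tendsto_charFun_bootstrapError {D : Measure 𝒵} {M : Measure 𝒮}
    [IsProbabilityMeasure D] [IsProbabilityMeasure M] (hg : Measurable g)
    (hg2 : MemLp g 2 (D.prod M)) {z : ℕ → 𝒵} {s : ℕ → 𝒮}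
    (h : IsTypicalArray D M (mainEffect D M g) (mainEffect M D fun q ↦ g q.swap)
      (interaction D M g) m k z s)
    (hm : Tendsto m atTop atTop) (hk : Tendsto k atTop atTop) {𝒱 : Type*} [MeasurableSpace 𝒱]
    {V : Ω → 𝒱} (hIJ : ∀ n, IsTwoWayResample P V (I n) (J n))
    {τa τb : ℝ} (hca : Tendsto (fun n ↦ c n ^ 2 / m n) atTop (𝓝 τa))
    (hcb : Tendsto (fun n ↦ c n ^ 2 / k n) atTop (𝓝 τb)) (t : ℝ) :
    Tendsto (fun n ↦ charFun ((P.map fun ω' ↦ (I n ω', J n ω')).map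
      fun u ↦ bootstrapError g (c n) ((z, s), u)) t) atTop
      (𝓝 (Real.exp (-((τa * (∫ z, mainEffect D M g z ^ 2 ∂D) +
        τb * (∫ s, mainEffect M D (fun q ↦ g q.swap) s ^ 2 ∂M)) * t ^ 2 / 2)) : ℝ)) := by
  have hgs : Measurable fun q : 𝒮 × 𝒵 ↦ g q.swap := hg.comp measurable_swap
  have key := h.tendsto_charFun (measurable_mainEffect hg) (measurable_mainEffect hgs)
    (memLp_mainEffect hg hg2) (memLp_mainEffect hgs (memLp_swap hg2)) (integral_mainEffect hg2)
    (integral_mainEffect (memLp_swap hg2)) hm hk (fun n ↦ (hIJ n).twoWayIID) hca hcb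
    eq_add_interaction t
  refine key.congr fun n ↦ ?_
  have hGm : Measurable fun u ↦ bootstrapError g (c n) (m := m n) (k := k n) ((z, s), u) :=
    (measurable_bootstrapError hg (c n)).comp measurable_prodMk_left
  rw [Measure.map_map hGm
    ((hIJ n).measurable_left.prodMk (hIJ n).measurable_right)]
  rfl

end Main

end MultiBootstrap

open MultiBootstrap in
theorem theorem1 {Ω 𝒳 𝒴 𝒮 ℱ : Type*} [MeasurableSpace Ω] [MeasurableSpace 𝒳]
    [MeasurableSpace 𝒴] [MeasurableSpace 𝒮]
    (P : Measure Ω) [IsProbabilityMeasure P]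
    (D : Measure (𝒳 × 𝒴)) [IsProbabilityMeasure D] (M : Measure 𝒮) [IsProbabilityMeasure M]
    -- the models and the per-example loss
    (f : 𝒮 → ℱ) (ℓ : 𝒳 → 𝒴 → ℱ → ℝ)
    (hℓ : Measurable fun q : (𝒳 × 𝒴) × 𝒮 ↦ ℓ q.1.1 q.1.2 (f q.2))
    (hsq : Integrable (fun q : (𝒳 × 𝒴) × 𝒮 ↦ ℓ q.1.1 q.1.2 (f q.2) ^ 2) (D.prod M))
    (hsq_seed : ∀ s, Integrable (fun z : 𝒳 × 𝒴 ↦ ℓ z.1 z.2 (f s) ^ 2) D)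
    (hsq_example : ∀ᵐ z ∂D, Integrable (fun s ↦ ℓ z.1 z.2 (f s) ^ 2) M)
    -- the two mean functions are not both almost surely constant
    (hnondeg : ¬ ((∃ c : ℝ, ∀ᵐ s ∂M, performance ℓ f D s = c) ∧
      (∃ c : ℝ, ∀ᵐ z ∂D, exampleMean ℓ f M z = c)))
    -- the sample sizes: `n = n_x + n_s`, and `n_s = p n` up to rounding
    (p : ℝ) (hp0 : 0 < p) (hp1 : p < 1) (nx ns : ℕ → ℕ)
    (hn : ∀ n, nx n + ns n = n) (hns : ∀ n, |(ns n : ℝ) - p * n| < 1)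
    -- the data
    (Z : ℕ → Ω → 𝒳 × 𝒴) (S : ℕ → Ω → 𝒮) (hZS : IsTwoWaySample P D M Z S)
    -- the bootstrap draws of examples and of seeds
    (I : (n : ℕ) → Ω → Fin (nx n) → Fin (nx n)) (J : (n : ℕ) → Ω → Fin (ns n) → Fin (ns n))
    (hIJ : ∀ n, IsTwoWayResample P (fun ω ↦ (fun i ↦ Z i ω, fun j ↦ S j ω)) (I n) (J n))
    -- the estimator and its bootstrap version
    (θhat θstar : ℕ → Ω → ℝ)
    (hθhat : ∀ n ω, θhat n ω =
      empTheta ℓ f (fun i : Fin (nx n) ↦ Z i ω) (fun j : Fin (ns n) ↦ S j ω))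
    (hθstar : ∀ n ω, θstar n ω =
      empTheta ℓ f (fun i : Fin (nx n) ↦ Z (I n ω i) ω) (fun j : Fin (ns n) ↦ S (J n ω j) ω)) :
    ∃ σ2 : ℝ≥0, 0 < σ2 ∧
      TendstoInDistribution (fun (n : ℕ) ω ↦ √(n : ℝ) * (θhat n ω - theta ℓ f D M)) atTop id
        (fun _ ↦ P) (gaussianReal 0 σ2) ∧
      -- conditionally on all the data
      CondTendstoInDistribution (fun n ω ↦ √(n : ℝ) * (θstar n ω - θhat n ω))
        (fun ω ↦ (fun i ↦ Z i ω, fun j ↦ S j ω)) P (gaussianReal 0 σ2) ∧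
      -- and conditionally on the test examples alone
      CondTendstoInDistribution (fun n ω ↦ √(n : ℝ) * (θstar n ω - θhat n ω))
        (fun ω i ↦ Z i ω) P (gaussianReal 0 σ2) := by
  set g : (𝒳 × 𝒴) × 𝒮 → ℝ := fun q ↦ ℓ q.1.1 q.1.2 (f q.2) with hgdef
  have hg2 : MemLp g 2 (D.prod M) :=
    (memLp_two_iff_integrable_sq hℓ.aestronglyMeasurable).2 hsq
  have hgs : Measurable fun q : 𝒮 × (𝒳 × 𝒴) ↦ g q.swap := hℓ.comp measurable_swap
  have hgs2 := memLp_swap hg2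
  have hθ : theta ℓ f D M = ∫ q, g q ∂(D.prod M) :=
    (integral_prod_symm g (hg2.integrable (by norm_num))).symm
  set a := mainEffect D M g
  set b := mainEffect M D fun q ↦ g q.swap
  set va := ∫ z, a z ^ 2 ∂D with hva
  set vb := ∫ s, b s ^ 2 ∂M with hvb
  have hva0 : 0 ≤ va := integral_nonneg fun _ ↦ sq_nonneg _
  have hvb0 : 0 ≤ vb := integral_nonneg fun _ ↦ sq_nonneg _
  have hp1' : 0 < 1 - p := by linarith
  have hvpos : 0 < (1 - p)⁻¹ * va + p⁻¹ * vb := by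
    by_contra hcon
    have h1 : 0 ≤ (1 - p)⁻¹ * va := by positivity
    have h2 : 0 ≤ p⁻¹ * vb := by positivity
    have h3 : (1 - p)⁻¹ * va = 0 := by linarith
    have h4 : p⁻¹ * vb = 0 := by linarith
    -- both main effects would vanish almost surely
    refine hnondeg ⟨⟨_, ae_const_of_integral_mainEffect_sq_eq_zero hgs hgs2 ?_⟩,
      ⟨_, ae_const_of_integral_mainEffect_sq_eq_zero hℓ hg2 ?_⟩⟩
    · exact (mul_eq_zero.1 h4).resolve_left (inv_ne_zero hp0.ne')
    · exact (mul_eq_zero.1 h3).resolve_left (inv_ne_zero hp1'.ne')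
  have hfx := tendsto_example_fraction hn hns
  have hfs := tendsto_seed_fraction hns
  have hcx := tendsto_sq_sqrt_div hp1' hfx
  have hcs := tendsto_sq_sqrt_div hp0 hfs
  obtain ⟨R₁, hR₁⟩ := exists_eventually_le_mul hp1' hfx
  obtain ⟨R₂, hR₂⟩ := exists_eventually_le_mul hp0 hfs
  have hRx := hR₁ (max R₁ R₂) (le_max_left _ _)
  have hRs := hR₂ (max R₁ R₂) (le_max_right _ _)
  have hnx := tendsto_atTop_of_eventually_le_mul hRx
  have hns' := tendsto_atTop_of_eventually_le_mul hRs
  set σ2 : ℝ≥0 := ((1 - p)⁻¹ * va + p⁻¹ * vb).toNNReal with hσ2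
  have hσ : (σ2 : ℝ) = (1 - p)⁻¹ * va + p⁻¹ * vb := Real.coe_toNNReal _ hvpos.le
  have hiid := hZS.twoWayIID
  have hT1 : ∀ (n : ℕ) ω, √(n : ℝ) * (θhat n ω - theta ℓ f D M) = √(n : ℝ) *
      (gridMean g (fun i : Fin (nx n) ↦ Z i ω) (fun j : Fin (ns n) ↦ S j ω) -
        ∫ q, g q ∂(D.prod M)) := fun n ω ↦ by
    rw [hθhat, hθ]
    rfl
  have hT2 : (fun (n : ℕ) ω ↦ √(n : ℝ) * (θstar n ω - θhat n ω)) = fun (n : ℕ) ω ↦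
      bootstrapError g √(n : ℝ) ((fun i ↦ Z i ω, fun j ↦ S j ω), (I n ω, J n ω)) := by
    funext n ω
    rw [hθhat, hθstar]
    rfl
  have htyp : ∀ᵐ ω ∂P, IsTypicalArray D M a b (interaction D M g) nx ns
      (fun i ↦ Z i ω) (fun j ↦ S j ω) :=
    hiid.ae_isTypicalArray (measurable_mainEffect hℓ) (measurable_mainEffect hgs)
      (measurable_interaction hℓ) (memLp_mainEffect hℓ hg2) (memLp_mainEffect hgs hgs2)
      (memLp_interaction hℓ hg2) (ae_integral_interaction_right hℓ hg2)
      (ae_integral_interaction_left hℓ hg2) (fun n ↦ by have := hn n; omega)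
      (fun n ↦ by have := hn n; omega) hRx hRs
  have hboot : ∀ z s, IsTypicalArray D M a b (interaction D M g) nx ns z s → ∀ t,
      Tendsto (fun n : ℕ ↦ charFun ((P.map fun ω' ↦ (I n ω', J n ω')).map
        fun u ↦ bootstrapError g √(n : ℝ) ((z, s), u)) t) atTop
        (𝓝 (charFun (gaussianReal 0 σ2) t)) := by
    intro z s h t
    rw [charFun_gaussianReal_zero_eq hσ]
    exact h.tendsto_charFun_bootstrapError hℓ hg2 hnx hns' hIJ hcx hcs t
  have hZm : Measurable fun ω i ↦ Z i ω := measurable_pi_lambda _ hZS.measurable_example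
  have hSm : Measurable fun ω j ↦ S j ω := measurable_pi_lambda _ hZS.measurable_seed
  refine ⟨σ2, Real.toNNReal_pos.2 hvpos, ⟨fun n ↦ ?_, aemeasurable_id, ?_⟩, ?_, ?_⟩
  · simp only [hT1]
    exact (((measurable_gridMean hℓ (fun i ↦ hZS.measurable_example i)
      fun j ↦ hZS.measurable_seed j).sub_const _).const_mul _).aemeasurable
  · refine ProbabilityMeasure.tendsto_of_tendsto_charFun fun t ↦ ?_
    simp only [ProbabilityMeasure.coe_mk, Measure.map_id, hT1]
    rw [charFun_gaussianReal_zero_eq hσ]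
    exact hiid.tendsto_charFun_gridMean hℓ hg2 hnx hns' hcx hcs t
  · rw [hT2]
    exact condTendstoInDistribution_of_indepFun (hZm.prodMk hSm)
      (fun n ↦ (hIJ n).measurable_left.prodMk (hIJ n).measurable_right)
      (fun n ↦ (hIJ n).indep_data) (fun n ↦ measurable_bootstrapError hℓ _)
      (htyp.mono fun ω hω ↦ hboot _ _ hω)
  · rw [hT2]
    refine condTendstoInDistribution_fst_of_indepFun
      (G := fun n : ℕ ↦ bootstrapError g √(n : ℝ)) hZm hSm
      (fun n ↦ (hIJ n).measurable_left.prodMk (hIJ n).measurable_right) hZS.indep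
      (fun n ↦ (hIJ n).indep_data) (fun n ↦ measurable_bootstrapError hℓ _) ?_
    have hSprob : IsProbabilityMeasure (P.map fun ω j ↦ S j ω) :=
      Measure.isProbabilityMeasure_map hSm.aemeasurable
    -- typicality is a measurable property of the data, so it passes to the law of the data
    have htyp' : ∀ᵐ v ∂((P.map fun ω i ↦ Z i ω).prod (P.map fun ω j ↦ S j ω)),
        IsTypicalArray D M a b (interaction D M g) nx ns v.1 v.2 := by
      rw [← (indepFun_iff_map_prod_eq_prod_map_map hZm.aemeasurable hSm.aemeasurable).1 hZS.indep,
        ae_map_iff (hZm.prodMk hSm).aemeasurable (measurableSet_isTypicalArray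
          (measurable_mainEffect hℓ) (measurable_mainEffect hgs) (measurable_interaction hℓ))]
      exact htyp
    filter_upwards [Measure.ae_ae_of_ae_prod htyp'] with z hz
    exact hz.mono fun s hs ↦ hboot z s hs
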